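/- For a topological space $X$ let $\mathrm{conv}(X)$ be the family of all $A\subseteq X$ that can be covered by the ranges of finitely many sequences convergent in $X$. For a countable ordinal $\alpha\ge 2$ let $\mathrm{conv}_\alpha=\mathrm{conv}(\omega^\alpha+1)$, where $\omega^\alpha+1=\{\xi:\xi\le\omega^\alpha\}$ carries the order topology (the same formula is used for $\alpha=0,1$). For a countable limit ordinal $\alpha$ let $$\mathrm{conv}_{<\alpha}=\{A\subseteq\omega^\alpha+1:\ \forall\beta<\alpha\ (A\cap\omega^\beta\in\mathrm{conv}_\beta)\},$$ where $A\cap\omega^\beta=\{\xi\in A:\xi<\omega^\beta\}$. An ideal on a set $X$ is a family of subsets of $X$ that is closed under subsets and finite unions, contains all finite sets, and does not contain $X$. Families of subsets of a countable set $X$ are viewed as subsets of the Cantor space $\{0,1\}^X$. For $n\geq 1$, a subset $S$ of a Polish space $Y$ is $\Sigma^0_n$-complete ($\Pi^0_n$-complete) if it is $\Sigma^0_n$ ($\Pi^0_n$) and every $\Sigma^0_n$ ($\Pi^0_n$) subset of every zero-dimensional Polish space $Z$ has the form $f^{-1}[S]$ for some continuous $f:Z\to Y$. For ideals $\mathcal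 I$ on $X$ and $\mathcal J$ on $Y$ write $\mathcal J\le_K\mathcal I$ if there is $f:X\to Y$ with $f^{-1}[A]\in\mathcal I$ for all $A\in\mathcal J$, and $\mathcal J<_K\mathcal I$ if $\mathcal J\le_K\mathcal I$ and $\mathcal I\not\le_K\mathcal J$. Then: 1. for every countable limit ordinal $\alpha$, $\mathrm{conv}_{<\alpha}$ is an ideal on $\omega^\alpha+1$ and is $\Pi^0_5$-complete; 2. for every countable ordinal $\alpha\ge2$, $\mathrm{conv}_\alpha$ is an ideal on $\omega^\alpha+1$ and is $\Sigma^0_4$-complete; 3. $\mathrm{conv}_\alpha<_K\mathrm{conv}_\beta$ for all countable ordinals $2\le\beta<\alpha$; 4. $\mathrm{conv}_{<\alpha}<_K\mathrm{conv}_{<\beta}$ for all countable limit ordinals $\beta<\alpha$; 5. $\mathrm{conv}_\alpha<_K\mathrm{conv}_{<\alpha}<_K\mathrm{conv}_\beta$ for every countable limit ordinal $\alpha$ and every $2\le\beta<\alpha$. -/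

import Mathlib

open Set Filter Topology
open scoped Ordinal

universe u v w

/-- `IsSigma0 n S`: the set `S` is `Σ⁰ₙ` (for finite `n ≥ 1`; there is no level `0`).
`Σ⁰₁` sets are the open sets, `Σ⁰ₙ₊₁` sets are the countable unions of `Π⁰ₙ` sets, and a set is
`Π⁰ₙ` when its complement is `Σ⁰ₙ`. -/
def IsSigma0 {X : Type u} [TopologicalSpace X] : ℕ → Set X → Prop
  | 0, _ => False
  | 1, S => IsOpen S
  | n + 2, S => ∃ P : ℕ → Set X, (∀ i, IsSigma0 (n + 1) (P i)ᶜ) ∧ S = ⋃ i, P i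

/-- `IsPi0 n S`: the set `S` is `Π⁰ₙ`. -/
def IsPi0 {X : Type u} [TopologicalSpace X] (n : ℕ) (S : Set X) : Prop :=
  IsSigma0 n Sᶜ

/-- A topological space is zero-dimensional if its clopen sets form a basis. -/
def IsZeroDimensional (X : Type u) [TopologicalSpace X] : Prop :=
  TopologicalSpace.IsTopologicalBasis {U : Set X | IsClopen U}

/-- `S ⊆ Y` is `Σ⁰ₙ`-complete: it is `Σ⁰ₙ`, and every `Σ⁰ₙ` subset of every zero-dimensional
Polish space (in the universe `v`) is the preimage of `S` under a continuous map. -/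
def IsSigma0Complete {Y : Type u} [TopologicalSpace Y] (n : ℕ) (S : Set Y) : Prop :=
  IsSigma0 n S ∧
    ∀ (X : Type v) [TopologicalSpace X] [PolishSpace X], IsZeroDimensional X →
      ∀ B : Set X, IsSigma0 n B → ∃ f : X → Y, Continuous f ∧ f ⁻¹' S = B

/-- `S ⊆ Y` is `Π⁰ₙ`-complete: it is `Π⁰ₙ`, and every `Π⁰ₙ` subset of every zero-dimensional
Polish space (in the universe `v`) is the preimage of `S` under a continuous map. -/
def IsPi0Complete {Y : Type u} [TopologicalSpace Y] (n : ℕ) (S : Set Y) : Prop :=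
  IsPi0 n S ∧
    ∀ (X : Type v) [TopologicalSpace X] [PolishSpace X], IsZeroDimensional X →
      ∀ B : Set X, IsPi0 n B → ∃ f : X → Y, Continuous f ∧ f ⁻¹' S = B

/-- An ideal on `X`: a proper family of subsets of `X`, closed under finite unions and under
subsets, that contains all finite sets. -/
structure IsIdealOn {X : Type u} (I : Set (Set X)) : Prop where
  empty_mem : ∅ ∈ I
  univ_notMem : univ ∉ I
  union_mem : ∀ A ∈ I, ∀ B ∈ I, A ∪ B ∈ I
  subset_mem : ∀ A B : Set X, A ⊆ B → B ∈ I → A ∈ I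
  finite_mem : ∀ A : Set X, A.Finite → A ∈ I

/-- `KatetovLE J I`: the ideal `J` on `Y` is below the ideal `I` on `X` in the Katětov order. -/
def KatetovLE {X : Type u} {Y : Type w} (J : Set (Set Y)) (I : Set (Set X)) : Prop :=
  ∃ f : X → Y, ∀ A ∈ J, f ⁻¹' A ∈ I

/-- `J` is strictly below `I` in the Katětov order. -/
def KatetovLT {X : Type u} {Y : Type w} (J : Set (Set Y)) (I : Set (Set X)) : Prop :=
  KatetovLE J I ∧ ¬ KatetovLE I J

/-- A family of subsets of `X`, viewed as a subset of the space `{0,1}^X` (with the product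
topology of the discrete two-point space) by identifying sets with characteristic functions. -/
def toCantor {X : Type u} (I : Set (Set X)) : Set (X → Bool) :=
  {χ | {x | χ x = true} ∈ I}

/-- The sets that can be covered by the ranges of finitely many convergent sequences in `X`. -/
def convIdeal (X : Type u) [TopologicalSpace X] : Set (Set X) :=
  {A | ∃ (k : ℕ) (d : Fin k → ℕ → X),
    (∀ i, ∃ p, Tendsto (d i) atTop (𝓝 p)) ∧ A ⊆ ⋃ i, range (d i)}

/-- The space `ω^α + 1 = {ξ : ξ ≤ ω^α}`. Its topology is the subspace topology from the order
topology of the ordinals, which is the order topology of `ω^α + 1`. -/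
abbrev OmegaPowSpace (α : Ordinal.{u}) : Type (u + 1) :=
  Iic (ω ^ α)

/-- The ideal `conv_α` on `ω^α + 1`. -/
def convOrd (α : Ordinal.{u}) : Set (Set (OmegaPowSpace α)) :=
  convIdeal (OmegaPowSpace α)

/-- The ideal `conv_{<α}` on `ω^α + 1`: all `A` with `A ∩ ω^β ∈ conv_β` for every `β < α`, where
`A ∩ ω^β = {ξ ∈ A : ξ < ω^β}` is regarded as a subset of `ω^β + 1`. -/
def convBelow (α : Ordinal.{u}) : Set (Set (OmegaPowSpace α)) :=
  {A | ∀ β < α,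
    {ξ : OmegaPowSpace β | (ξ : Ordinal) ∈ ((↑) '' A : Set Ordinal) ∩ Iio (ω ^ β)} ∈ convOrd β}

/-! ### Convergent sequences and accumulation points. -/

section ConvIdeal

variable {X : Type u} [TopologicalSpace X]

/-! In a compact Hausdorff space a countable set belongs to the conv ideal iff its derived set is
finite (`mem_convIdeal_iff`). All the statements thus become counts of accumulation points of sets
of ordinals.

Complexity. "Some finite F contains every accumulation point" is a countable union of countable
intersections of Σ⁰₂ conditions, hence Σ⁰₄; membership in `convBelow α` is a countable intersection
of such conditions. For hardness, every Σ⁰₄ set reduces to the subsets of ℕ × ℕ with finitely many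
infinite sections (`IsZeroDimensional.exists_reduction_of_isSigma0_four`). The map `blockPoint η`
places ℕ × ℕ in a block of type ω², where section n can accumulate only at η + ω(n+1) and the sole
further candidate is η + ω². One block gives Σ⁰₄-hardness; a sequence of blocks starting at ω^γₖ,
with γₖ cofinal in α, gives Π⁰₅-hardness, since ω^β meets only finitely many of them.

Katětov order. The reductions are inclusions and identities. For strictness, let f : ω^α + 1 → ω^β +
1 witness conv_β ≤ conv_α and consider its cluster values at each point. A given y is a cluster
value at only finitely many points, and this finiteness lets Cantor–Bendixson rank propagate: for γ
> 1, each point of rank at least γ has a cluster value of rank at least γ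
(`clusterSet_inter_rankGE_nonempty`). If β < α, infinitely many points of rank at least β compete
for the single value ω^β, a contradiction. The same lemma separates conv_{<α} from conv_α, and
composition yields the rest. -/

theorem convIdeal_mono {A B : Set X} (h : A ⊆ B) (hB : B ∈ convIdeal X) : A ∈ convIdeal X := by
  obtain ⟨k, d, hd, hBd⟩ := hB
  exact ⟨k, d, hd, h.trans hBd⟩

theorem convIdeal_empty : (∅ : Set X) ∈ convIdeal X :=
  ⟨0, Fin.elim0, fun i => i.elim0, empty_subset _⟩

theorem convIdeal_range {d : ℕ → X} {p : X} (h : Tendsto d atTop (𝓝 p)) :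
    range d ∈ convIdeal X :=
  ⟨1, fun _ => d, fun _ => ⟨p, h⟩, subset_iUnion (fun _ : Fin 1 => range d) 0⟩

theorem convIdeal_singleton (x : X) : {x} ∈ convIdeal X :=
  convIdeal_mono (by simp) (convIdeal_range (d := fun _ => x) tendsto_const_nhds)

theorem convIdeal_union {A B : Set X} (hA : A ∈ convIdeal X) (hB : B ∈ convIdeal X) :
    A ∪ B ∈ convIdeal X := by
  obtain ⟨k, d, hd, hA⟩ := hA
  obtain ⟨l, e, he, hB⟩ := hB
  refine ⟨k + l, Fin.append d e, fun i => ?_, ?_⟩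
  · refine Fin.addCases (fun i => ?_) (fun i => ?_) i
    · simpa using hd i
    · simpa using he i
  · rintro x (hx | hx)
    · obtain ⟨i, hi⟩ := mem_iUnion.1 (hA hx)
      exact mem_iUnion.2 ⟨Fin.castAdd l i, by simpa using hi⟩
    · obtain ⟨i, hi⟩ := mem_iUnion.1 (hB hx)
      exact mem_iUnion.2 ⟨Fin.natAdd k i, by simpa using hi⟩

theorem convIdeal_biUnion {ι : Type*} {s : Set ι} (hs : s.Finite) {A : ι → Set X}
    (h : ∀ i ∈ s, A i ∈ convIdeal X) : ⋃ i ∈ s, A i ∈ convIdeal X := by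
  induction s, hs using Set.Finite.induction_on with
  | empty => simpa using convIdeal_empty
  | insert _ _ ih =>
    rw [biUnion_insert]
    exact convIdeal_union (h _ (mem_insert _ _)) (ih fun i hi => h i (mem_insert_of_mem _ hi))

theorem convIdeal_finite {A : Set X} (h : A.Finite) : A ∈ convIdeal X := by
  have := convIdeal_biUnion h (A := fun x : X => {x}) fun x _ => convIdeal_singleton x
  simpa using this

theorem derivedSet_eq_empty_of_finite [T1Space X] {A : Set X} (h : A.Finite) :
    derivedSet A = ∅ := by
  refine eq_empty_of_forall_notMem fun x hx => ?_
  rw [mem_derivedSet, accPt_iff_nhds] at hx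
  have hU : (A \ {x})ᶜ ∈ 𝓝 x :=
    (h.subset sdiff_subset).isClosed.isOpen_compl.mem_nhds (by simp)
  obtain ⟨y, ⟨hy, hyA⟩, hyx⟩ := hx _ hU
  exact hy ⟨hyA, hyx⟩

theorem infinite_inter_of_accPt [T1Space X] {A U : Set X} {x : X} (h : AccPt x (𝓟 A))
    (hU : U ∈ 𝓝 x) : (U ∩ A).Infinite := by
  intro hf
  have := derivedSet_eq_empty_of_finite hf
  exact (this ▸ (h.nhds_inter hU : x ∈ derivedSet (U ∩ A)) : x ∈ (∅ : Set X))

theorem derivedSet_range_subset [T2Space X] {d : ℕ → X} {p : X} (h : Tendsto d atTop (𝓝 p)) :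
    derivedSet (range d) ⊆ {p} := by
  intro x hx
  by_contra hne
  obtain ⟨U, V, hU, hV, hxU, hpV, hUV⟩ := t2_separation (show x ≠ p from hne)
  refine infinite_inter_of_accPt hx (hU.mem_nhds hxU) ?_
  obtain ⟨N, hN⟩ := eventually_atTop.1 (h (hV.mem_nhds hpV))
  refine ((finite_lt_nat N).image d).subset ?_
  rintro _ ⟨hyU, n, rfl⟩
  refine ⟨n, ?_, rfl⟩
  by_contra hn
  exact disjoint_left.1 hUV hyU (hN n (not_lt.1 hn))

theorem derivedSet_biUnion {ι : Type*} {s : Set ι} (hs : s.Finite) (A : ι → Set X) :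
    derivedSet (⋃ i ∈ s, A i) = ⋃ i ∈ s, derivedSet (A i) := by
  induction s, hs using Set.Finite.induction_on with
  | empty =>
    simp [derivedSet, AccPt, neBot_iff]
  | insert _ _ ih => rw [biUnion_insert, biUnion_insert, derivedSet_union, ih]

theorem derivedSet_finite_of_mem_convIdeal [T2Space X] {A : Set X} (h : A ∈ convIdeal X) :
    (derivedSet A).Finite := by
  obtain ⟨k, d, hd, hA⟩ := h
  refine Finite.subset ?_ (derivedSet_mono _ _ hA)
  have := derivedSet_biUnion (finite_univ (α := Fin k)) fun i => range (d i)
  simp only [mem_univ, iUnion_true] at this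
  rw [this]
  refine finite_iUnion fun i => ?_
  obtain ⟨p, hp⟩ := hd i
  exact (finite_singleton p).subset (derivedSet_range_subset hp)

/-- Any enumeration of an infinite such A converges to p: infinitely many terms outside a
neighbourhood of p would accumulate, necessarily at p, which is impossible. -/
theorem mem_convIdeal_of_derivedSet_subset [CompactSpace X] {A : Set X} (hA : A.Countable) {p : X}
    (h : derivedSet A ⊆ {p}) : A ∈ convIdeal X := by
  by_cases hf : A.Finite
  · exact convIdeal_finite hf
  have : Countable A := hA
  have : Infinite A := infinite_coe_iff.2 hf
  obtain ⟨e⟩ := nonempty_equiv_of_countable (α := ℕ) (β := A)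
  have ht : Tendsto (fun n => (e n : X)) atTop (𝓝 p) := by
    rw [← Nat.cofinite_eq_atTop]
    intro V hV
    rw [mem_map, mem_cofinite]
    by_contra hinf
    have hinf : ((fun n => (e n : X)) ⁻¹' V)ᶜ.Infinite := hinf
    have hi : ((fun n => (e n : X)) '' ((fun n => (e n : X)) ⁻¹' V)ᶜ).Infinite :=
      hinf.image (Subtype.val_injective.comp e.injective).injOn
    obtain ⟨q, hq⟩ := hi.exists_accPt_principal
    have hqA : q ∈ derivedSet A :=
      hq.mono (principal_mono.2 (by rintro _ ⟨n, _, rfl⟩; exact (e n).2))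
    obtain rfl : q = p := h hqA
    obtain ⟨y, ⟨hy, n, hn, rfl⟩, -⟩ := accPt_iff_nhds.1 hq V hV
    exact hn hy
  refine convIdeal_mono ?_ (convIdeal_range ht)
  intro x hx
  exact ⟨e.symm ⟨x, hx⟩, by simp⟩

/-- In a compact Hausdorff space, a countable set is covered by finitely many convergent sequences
iff it has finitely many accumulation points. -/
theorem mem_convIdeal_iff [T2Space X] [CompactSpace X] {A : Set X} (hA : A.Countable) :
    A ∈ convIdeal X ↔ (derivedSet A).Finite := by
  refine ⟨derivedSet_finite_of_mem_convIdeal, fun h => ?_⟩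
  -- Disjoint neighbourhoods of the finitely many accumulation points cut A into pieces with at most
  -- one accumulation point each; the remainder has none, so it is finite by compactness.
  obtain ⟨U, hU, hdis⟩ := h.t2_separation
  have hcov : A ⊆ (A \ ⋃ p ∈ derivedSet A, U p) ∪ ⋃ p ∈ derivedSet A, A ∩ U p := by
    intro x hx
    by_cases hxU : x ∈ ⋃ p ∈ derivedSet A, U p
    · right
      simp only [mem_iUnion, mem_inter_iff, exists_prop] at hxU ⊢
      obtain ⟨p, hp, hxp⟩ := hxU
      exact ⟨p, hp, hx, hxp⟩
    · exact Or.inl ⟨hx, hxU⟩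
  refine convIdeal_mono hcov (convIdeal_union (convIdeal_finite ?_) (convIdeal_biUnion h ?_))
  · by_contra hinf
    obtain ⟨q, hq⟩ := Set.Infinite.exists_accPt_principal hinf
    have hqA : q ∈ derivedSet A := hq.mono (principal_mono.2 sdiff_subset)
    obtain ⟨y, ⟨hyU, hy⟩, -⟩ := accPt_iff_nhds.1 hq (U q) ((hU q).2.mem_nhds (hU q).1)
    exact hy.2 (mem_biUnion hqA hyU)
  · intro p hp
    refine mem_convIdeal_of_derivedSet_subset (hA.mono inter_subset_left) (p := p) ?_
    intro q hq
    have hqA : q ∈ derivedSet A := derivedSet_mono _ _ inter_subset_left hq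
    by_contra hne
    obtain ⟨y, ⟨hyU, hy⟩, -⟩ := accPt_iff_nhds.1 hq (U q) ((hU q).2.mem_nhds (hU q).1)
    exact disjoint_left.1 (hdis hqA hp hne) hyU hy.2

end ConvIdeal

/-! ### Passing from the spaces ω^α + 1 to sets of ordinals. -/

section OmegaPowSpace

variable {α β : Ordinal.{u}}

theorem countable_Iic_omega0_opow (h : α.card ≤ Cardinal.aleph0) :
    (Iic (ω ^ α)).Countable := by
  have h1 : (ω ^ α).card ≤ Cardinal.aleph0 :=
    (Ordinal.card_opow_le _ _).trans (by simp [h])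
  have h2 : (Iio (ω ^ α)).Countable := by
    rw [← Cardinal.le_aleph0_iff_set_countable, Cardinal.mk_Iio_ordinal]
    simpa using Cardinal.lift_le.{u + 1}.2 h1
  rw [← Iio_insert]
  exact h2.insert _

theorem compactSpace_Iic_ordinal (o : Ordinal.{u}) : CompactSpace (Iic o) := by
  rw [← isCompact_iff_compactSpace, ← Icc_bot]
  exact isCompact_Icc

theorem secondCountableTopology_Iic_ordinal {o : Ordinal.{u}} (h : (Iic o).Countable) :
    SecondCountableTopology (Iic o) := by
  have : Countable (Iic o) := h
  refine ⟨⟨{s | ∃ a : Iic o, s = Ioi a ∨ s = Iio a}, ?_,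
    OrderTopology.topology_eq_generate_intervals⟩⟩
  have : {s | ∃ a : Iic o, s = Ioi a ∨ s = Iio a} = range Ioi ∪ range Iio := by
    ext s
    simp only [mem_ofPred_eq, mem_union, mem_range]
    grind
  rw [this]
  exact (countable_range _).union (countable_range _)

theorem isOpen_Iic_ordinal (o : Ordinal.{u}) : IsOpen (Iic o) := by
  rw [← Order.Iio_succ]
  exact isOpen_Iio

/-- Since `Iic o` is clopen, accumulation can be computed among all ordinals, independently of the
ambient ω^α + 1. -/
theorem derivedSet_image_val_Iic (o : Ordinal.{u}) (A : Set (Iic o)) :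
    derivedSet (Subtype.val '' A) = Subtype.val '' derivedSet A := by
  apply Subset.antisymm
  · intro x hx
    have hxo : x ∈ Iic o := isClosed_Iic.closure_subset_iff.2
      (by rintro _ ⟨y, -, rfl⟩; exact y.2) (derivedSet_subset_closure _ hx)
    refine ⟨⟨x, hxo⟩, ?_, rfl⟩
    rw [mem_derivedSet, accPt_iff_nhds] at hx ⊢
    intro U hU
    obtain ⟨y, ⟨⟨z, hz, rfl⟩, ⟨z', hz', hzz⟩⟩, hyx⟩ :=
      hx (Subtype.val '' U) ((isOpen_Iic_ordinal o).isOpenMap_subtype_val.image_mem_nhds hU)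
    obtain rfl := Subtype.ext hzz
    exact ⟨z', ⟨hz, hz'⟩, fun h => hyx (by rw [h])⟩
  · exact Continuous.image_derivedSet continuous_subtype_val Subtype.val_injective

theorem mem_convOrd_iff (h : α.card ≤ Cardinal.aleph0) {A : Set (OmegaPowSpace α)} :
    A ∈ convOrd α ↔ (derivedSet (Subtype.val '' A)).Finite := by
  have := compactSpace_Iic_ordinal (ω ^ α)
  have hc : Countable (Iic (ω ^ α)) := countable_Iic_omega0_opow h
  rw [derivedSet_image_val_Iic, finite_image_iff Subtype.val_injective.injOn]
  exact mem_convIdeal_iff A.to_countable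

theorem card_le_aleph0_of_le (h : α.card ≤ Cardinal.aleph0) (hβ : β ≤ α) :
    β.card ≤ Cardinal.aleph0 :=
  (Ordinal.card_le_card hβ).trans h

theorem mem_convBelow_iff (h : α.card ≤ Cardinal.aleph0) {A : Set (OmegaPowSpace α)} :
    A ∈ convBelow α ↔ ∀ β < α, (derivedSet (Subtype.val '' A ∩ Iio (ω ^ β))).Finite := by
  refine forall₂_congr fun β hβ => ?_
  rw [mem_convOrd_iff (card_le_aleph0_of_le h hβ.le)]
  have : (Subtype.val '' {ξ : OmegaPowSpace β |
      (ξ : Ordinal) ∈ ((↑) '' A : Set Ordinal) ∩ Iio (ω ^ β)})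
      = Subtype.val '' A ∩ Iio (ω ^ β) := by
    ext x
    constructor
    · rintro ⟨y, hy, rfl⟩
      exact hy
    · intro hx
      exact ⟨⟨x, (mem_Iio.1 hx.2).le⟩, hx, rfl⟩
  rw [this]

end OmegaPowSpace

/-! ### Closure properties of the finite Borel levels. -/

section BorelHierarchy

variable {X : Type u} [TopologicalSpace X]

theorem isSigma0_one {S : Set X} : IsSigma0 1 S ↔ IsOpen S := by rw [IsSigma0]

theorem isSigma0_add_two {n : ℕ} {S : Set X} : IsSigma0 (n + 2) S ↔
    ∃ P : ℕ → Set X, (∀ i, IsSigma0 (n + 1) (P i)ᶜ) ∧ S = ⋃ i, P i := by rw [IsSigma0]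

theorem isSigma0_of_compl {n : ℕ} {S : Set X} (h : IsSigma0 (n + 1) Sᶜ) : IsSigma0 (n + 2) S :=
  isSigma0_add_two.2 ⟨fun _ => S, fun _ => h, (iUnion_const S).symm⟩

theorem isSigma0_two_of_isClosed {S : Set X} (h : IsClosed S) : IsSigma0 2 S :=
  isSigma0_of_compl (isSigma0_one.2 h.isOpen_compl)

theorem isSigma0_empty_and_univ (n : ℕ) :
    IsSigma0 (n + 1) (∅ : Set X) ∧ IsSigma0 (n + 1) (univ : Set X) := by
  induction n with
  | zero => exact ⟨isSigma0_one.2 isOpen_empty, isSigma0_one.2 isOpen_univ⟩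
  | succ n ih =>
    exact ⟨isSigma0_of_compl (by simpa using ih.2), isSigma0_of_compl (by simpa using ih.1)⟩

theorem IsSigma0.iUnion {ι : Type*} [Countable ι] {n : ℕ} {S : ι → Set X}
    (h : ∀ i, IsSigma0 (n + 1) (S i)) : IsSigma0 (n + 1) (⋃ i, S i) := by
  cases n with
  | zero => exact isSigma0_one.2 (isOpen_iUnion fun i => isSigma0_one.1 (h i))
  | succ n =>
    rcases isEmpty_or_nonempty ι with hι | hι
    · simpa using (isSigma0_empty_and_univ (n + 1)).1
    choose P hP hS using fun i => isSigma0_add_two.1 (h i)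
    obtain ⟨g, hg⟩ := exists_surjective_nat ι
    refine isSigma0_add_two.2 ⟨fun k => P (g k.unpair.1) k.unpair.2, fun k => hP _ _, ?_⟩
    ext x
    simp only [mem_iUnion, hS]
    constructor
    · rintro ⟨i, j, hx⟩
      obtain ⟨k, rfl⟩ := hg i
      exact ⟨Nat.pair k j, by simpa using hx⟩
    · rintro ⟨k, hx⟩
      exact ⟨_, _, hx⟩

theorem isSigma0_iUnion_of_compl {ι : Type*} [Countable ι] {n : ℕ} {S : ι → Set X}
    (h : ∀ i, IsSigma0 (n + 1) (S i)ᶜ) : IsSigma0 (n + 2) (⋃ i, S i) :=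
  IsSigma0.iUnion fun i => isSigma0_of_compl (h i)

theorem IsSigma0.union {n : ℕ} {S T : Set X} (hS : IsSigma0 (n + 1) S) (hT : IsSigma0 (n + 1) T) :
    IsSigma0 (n + 1) (S ∪ T) := by
  rw [union_eq_iUnion]
  exact IsSigma0.iUnion (by simp [hS, hT])

theorem IsSigma0.preimage {Y : Type v} [TopologicalSpace Y] {f : X → Y} (hf : Continuous f) :
    ∀ {n : ℕ} {S : Set Y}, IsSigma0 (n + 1) S → IsSigma0 (n + 1) (f ⁻¹' S) := by
  intro n
  induction n with
  | zero => exact fun h => isSigma0_one.2 ((isSigma0_one.1 h).preimage hf)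
  | succ n ih =>
    intro S h
    obtain ⟨P, hP, rfl⟩ := isSigma0_add_two.1 h
    exact isSigma0_add_two.2 ⟨fun i => f ⁻¹' P i, fun i => ih (hP i), preimage_iUnion⟩

theorem isSigma0_two_iff_of_closed {S : Set X} :
    IsSigma0 2 S ↔ ∃ F : ℕ → Set X, (∀ i, IsClosed (F i)) ∧ S = ⋃ i, F i := by
  simp only [isSigma0_add_two, zero_add, isSigma0_one, isOpen_compl_iff]

end BorelHierarchy

/-! ### Upper bounds: Σ⁰₄ and Π⁰₅. -/

section Complexity

theorem isSigma0_toCantor_convIdeal {X : Type u} [TopologicalSpace X] [Countable X] [T2Space X]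
    [CompactSpace X] [SecondCountableTopology X] : IsSigma0 4 (toCantor (convIdeal X)) := by
  let b := TopologicalSpace.countableBasis X
  have hb : Countable b := TopologicalSpace.countable_countableBasis X
  -- `C x U` says that the basic set U isolates x from the coded set; this is closed in the code.
  let C (x : X) (U : b) : Set (X → Bool) := {χ | x ∈ U.1 ∧ ∀ z ∈ U.1, z ≠ x → χ z = false}
  have hC (x : X) (U : b) : IsClosed (C x U) := by
    have : C x U = {_χ | x ∈ U.1} ∩ ⋂ z ∈ U.1 \ {x}, {χ | χ z = false} := by
      ext χ
      simp [C]
    rw [this]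
    exact isClosed_const.inter (isClosed_biInter fun z _ =>
      isClosed_eq (continuous_apply z) continuous_const)
  have key : toCantor (convIdeal X) =
      ⋃ F : Finset X, (⋃ x : {x // x ∉ F}, (⋃ U : b, C x.1 U)ᶜ)ᶜ := by
    ext χ
    have hacc (x : X) : x ∉ derivedSet {z | χ z = true} ↔ χ ∈ ⋃ U : b, C x U := by
      rw [mem_derivedSet, accPt_iff_nhds]
      simp only [mem_iUnion, C, not_forall, exists_prop, not_exists, not_and, mem_inter_iff]
      constructor
      · rintro ⟨U, hU, h⟩
        obtain ⟨V, hV, hxV, hVU⟩ :=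
          (TopologicalSpace.isBasis_countableBasis X).mem_nhds_iff.1 hU
        refine ⟨⟨V, hV⟩, hxV, fun z hz hne => ?_⟩
        by_contra hχ
        exact h z ⟨hVU hz, by simpa using hχ⟩ hne
      · rintro ⟨V, hxV, h⟩
        refine ⟨V, (TopologicalSpace.isOpen_of_mem_countableBasis V.2).mem_nhds hxV, ?_⟩
        rintro z ⟨hzV, hz⟩ hne
        have := h z hzV hne
        simp_all
    change {z | χ z = true} ∈ convIdeal X ↔ _
    rw [mem_convIdeal_iff (to_countable _)]
    simp only [mem_iUnion, mem_compl_iff, not_exists]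
    constructor
    · intro h
      refine ⟨h.toFinset, fun x => ?_⟩
      have := (hacc x.1).1 (by simpa using x.2)
      simpa using this
    · rintro ⟨F, hF⟩
      refine F.finite_toSet.subset fun x hx => ?_
      by_contra hxF
      refine (hacc x).2 ?_ hx
      simpa using hF ⟨x, hxF⟩
  rw [key]
  refine isSigma0_iUnion_of_compl fun F => ?_
  rw [compl_compl]
  refine isSigma0_iUnion_of_compl fun x => ?_
  rw [compl_compl]
  exact IsSigma0.iUnion fun U => isSigma0_two_of_isClosed (hC _ U)

theorem isSigma0_toCantor_convOrd {α : Ordinal.{u}} (h : α.card ≤ Cardinal.aleph0) :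
    IsSigma0 4 (toCantor (convOrd α)) := by
  have hc := countable_Iic_omega0_opow h
  have := compactSpace_Iic_ordinal (ω ^ α)
  have := secondCountableTopology_Iic_ordinal hc
  have : Countable (OmegaPowSpace α) := hc
  exact isSigma0_toCantor_convIdeal

theorem countable_Iio_of_card_le {α : Ordinal.{u}} (h : α.card ≤ Cardinal.aleph0) :
    (Iio α).Countable := by
  rw [← Cardinal.le_aleph0_iff_set_countable, Cardinal.mk_Iio_ordinal]
  simpa using Cardinal.lift_le.{u + 1}.2 h

theorem isPi0_toCantor_convBelow {α : Ordinal.{u}} (h : α.card ≤ Cardinal.aleph0) :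
    IsPi0 5 (toCantor (convBelow α)) := by
  have : Countable (Iio α) := countable_Iio_of_card_le h
  have hle (β : Iio α) : ω ^ β.1 ≤ ω ^ α :=
    Ordinal.opow_le_opow_right Ordinal.omega0_pos (le_of_lt (mem_Iio.1 β.2))
  -- Restriction to ω^β; the extra top point of ω^β + 1 gets the value `false`.
  let g (β : Iio α) (χ : OmegaPowSpace α → Bool) : OmegaPowSpace β.1 → Bool := fun ξ =>
    if ξ.1 < ω ^ β.1 then χ ⟨ξ.1, (mem_Iic.1 ξ.2).trans (hle β)⟩ else false
  have hg (β : Iio α) : Continuous (g β) := by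
    refine continuous_pi fun ξ => ?_
    by_cases hξ : ξ.1 < ω ^ β.1
    · simpa only [g, hξ, if_true] using continuous_apply _
    · simpa only [g, hξ, if_false] using continuous_const
  have hset (β : Iio α) (χ : OmegaPowSpace α → Bool) : {ξ | g β χ ξ = true} =
      {ξ | ξ.1 ∈ ((↑) '' {x | χ x = true} : Set Ordinal) ∩ Iio (ω ^ β.1)} := by
    ext ξ
    by_cases hξ : ξ.1 < ω ^ β.1
    · simp [g, hξ, hξ.le.trans (hle β)]
    · simp [g, hξ]
  have key : (toCantor (convBelow α))ᶜ = ⋃ β : Iio α, (g β ⁻¹' toCantor (convOrd β.1))ᶜ := by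
    rw [← compl_iInter, compl_inj_iff]
    ext χ
    simp only [mem_iInter, mem_preimage]
    refine ⟨fun hχ β => ?_, fun hχ β hβ => ?_⟩
    · change {ξ | g β χ ξ = true} ∈ convOrd β.1
      rw [hset]
      exact hχ β.1 β.2
    · rw [← hset ⟨β, hβ⟩ χ]
      exact hχ ⟨β, hβ⟩
  rw [IsPi0, key]
  refine isSigma0_iUnion_of_compl fun β => ?_
  rw [compl_compl]
  exact (isSigma0_toCantor_convOrd (card_le_aleph0_of_le h (mem_Iio.1 β.2).le)).preimage (hg β)

end Complexity

/-! ### A combinatorial Σ⁰₄-complete form on ℕ × ℕ. -/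

section Reduction

variable {X : Type v} [TopologicalSpace X]

theorem IsZeroDimensional.exists_clopen_iUnion [SecondCountableTopology X]
    (hX : IsZeroDimensional X) {U : Set X} (hU : IsOpen U) :
    ∃ C : ℕ → Set X, (∀ n, IsClopen (C n)) ∧ U = ⋃ n, C n := by
  obtain ⟨T, hTc, hTS, hTU⟩ := TopologicalSpace.isOpen_sUnion_countable
    {s | s ∈ {V : Set X | IsClopen V} ∧ s ⊆ U} fun s hs => hs.1.isOpen
  rw [← hX.open_eq_sUnion' hU] at hTU
  obtain ⟨C, hC⟩ := (hTc.insert ∅).exists_eq_range (insert_nonempty _ _)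
  refine ⟨C, fun n => ?_, ?_⟩
  · rcases (hC ▸ mem_range_self n : C n ∈ insert ∅ T) with h | h
    · exact h ▸ isClopen_empty
    · exact (hTS h).1
  · rw [← sUnion_range, ← hC, sUnion_insert, empty_union, hTU]

theorem IsZeroDimensional.isSigma0_two_of_isOpen [SecondCountableTopology X]
    (hX : IsZeroDimensional X) {U : Set X} (hU : IsOpen U) : IsSigma0 2 U := by
  obtain ⟨C, hC, rfl⟩ := hX.exists_clopen_iUnion hU
  exact IsSigma0.iUnion fun n => isSigma0_two_of_isClosed (hC n).isClosed

theorem isClopen_disjointed {C : ℕ → Set X} (h : ∀ n, IsClopen (C n)) (n : ℕ) :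
    IsClopen (disjointed C n) := by
  rw [disjointed_apply]
  refine (h n).diff ?_
  rw [Finset.sup_eq_iSup]
  exact (Finset.finite_toSet _).isClopen_biUnion fun i _ => h i

/-- A `Σ⁰₂` subset of a zero-dimensional space is the preimage of the finite sets of naturals. -/
theorem IsZeroDimensional.exists_finite_iff_of_isSigma0_two [SecondCountableTopology X]
    (hX : IsZeroDimensional X) {T : Set X} (hT : IsSigma0 2 T) :
    ∃ y : ℕ → Set X, (∀ m, IsClopen (y m)) ∧ ∀ x, x ∈ T ↔ {m | x ∈ y m}.Finite := by
  obtain ⟨F, hF, rfl⟩ := isSigma0_two_iff_of_closed.1 hT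
  -- The `G k` increase, so x ∈ T iff x misses only finitely many of them. The complement of `G k`
  -- splits into disjoint clopen pieces, and m codes a pair (k, j): each k with x ∉ `G k`
  -- contributes exactly one m, the piece containing x.
  let G (k : ℕ) : Set X := ⋃ i ∈ Iic k, F i
  have hG (k : ℕ) : IsClosed (G k) := (finite_Iic k).isClosed_biUnion fun i _ => hF i
  choose C hC hGC using fun k => hX.exists_clopen_iUnion (hG k).isOpen_compl
  refine ⟨fun m => disjointed (C m.unpair.1) m.unpair.2, fun m => isClopen_disjointed (hC _) _,
    fun x => ?_⟩
  have hmem (k : ℕ) : x ∉ G k ↔ ∃ m, x ∈ disjointed (C k) m := by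
    rw [← mem_compl_iff, hGC, ← iUnion_disjointed, mem_iUnion]
  constructor
  · intro hx
    obtain ⟨i, hi⟩ := mem_iUnion.1 hx
    refine Finite.of_finite_image (f := fun m => m.unpair.1) ?_ ?_
    · refine (finite_lt_nat i).subset ?_
      rintro _ ⟨m, hm, rfl⟩
      by_contra hle
      exact (hmem _).2 ⟨_, hm⟩ (mem_biUnion (mem_Iic.2 (not_lt.1 hle)) hi)
    · intro m hm m' hm' h
      have h : m.unpair.1 = m'.unpair.1 := h
      have hm : x ∈ disjointed (C m.unpair.1) m.unpair.2 := hm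
      have hm' : x ∈ disjointed (C m'.unpair.1) m'.unpair.2 := hm'
      rw [← h] at hm'
      have h2 : m.unpair.2 = m'.unpair.2 := by
        by_contra hne
        exact disjoint_left.1 (disjoint_disjointed (C m.unpair.1) hne) hm hm'
      rw [← Nat.pair_unpair m, ← Nat.pair_unpair m', h, h2]
  · intro hfin
    by_contra hx
    have hx' (k : ℕ) : x ∉ G k := by
      simp only [G, mem_iUnion, not_exists] at hx ⊢
      exact fun i _ => hx i
    choose m hm using fun k => (hmem k).1 (hx' k)
    refine infinite_of_injective_forall_mem (f := fun k => Nat.pair k (m k)) ?_ ?_ hfin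
    · intro k k' h
      exact (Nat.pair_eq_pair.1 h).1
    · intro k
      simpa using hm k

/-- A `Σ⁰₃` subset of a zero-dimensional space is a disjoint union of countably many `Π⁰₂` sets. -/
theorem IsZeroDimensional.exists_disjoint_of_isSigma0_three [SecondCountableTopology X]
    (hX : IsZeroDimensional X) {Q : Set X} (hQ : IsSigma0 3 Q) :
    ∃ D : (Σ n : ℕ, Fin n → ℕ) → Set X, (∀ c, IsSigma0 2 (D c)ᶜ) ∧ Q = ⋃ c, D c ∧
      ∀ x c c', x ∈ D c → x ∈ D c' → c = c' := by
  obtain ⟨R, hR, rfl⟩ := isSigma0_add_two.1 hQ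
  choose F hF hRF using fun n => isSigma0_two_iff_of_closed.1 (hR n)
  have hdisj (n k : ℕ) : IsSigma0 2 (disjointed (F n) k)ᶜ := by
    rw [disjointed_apply, Finset.sup_eq_iSup, compl_sdiff]
    refine IsSigma0.union (n := 1) ?_ (hX.isSigma0_two_of_isOpen (hF n k).isOpen_compl)
    exact isSigma0_two_of_isClosed ((Finset.finite_toSet _).isClosed_biUnion fun i _ => hF n i)
  -- The index of x is forced: n is the first stage with x ∈ `R n`, and s names, for each l < n, the
  -- piece of the disjointed complement of `R l` containing x.
  refine ⟨fun c => R c.1 ∩ ⋂ l : Fin c.1, disjointed (F l) (c.2 l), fun c => ?_, ?_, ?_⟩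
  · rw [compl_inter, compl_iInter]
    exact IsSigma0.union (n := 1) (hR _) (IsSigma0.iUnion fun l => hdisj _ _)
  · apply Subset.antisymm
    · intro x hx
      classical
      have hex := mem_iUnion.1 hx
      have hlt (l : Fin (Nat.find hex)) : ∃ k, x ∈ disjointed (F l) k := by
        have : x ∈ (R l)ᶜ := Nat.find_min hex l.2
        rwa [hRF, ← iUnion_disjointed, mem_iUnion] at this
      choose s hs using hlt
      exact mem_iUnion.2 ⟨⟨Nat.find hex, s⟩, Nat.find_spec hex, mem_iInter.2 hs⟩
    · exact iUnion_subset fun c => inter_subset_left.trans (subset_iUnion R _)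
  · have hle : ∀ x, ∀ c c' : (Σ n : ℕ, Fin n → ℕ),
        x ∈ R c.1 → x ∈ ⋂ l : Fin c'.1, disjointed (F l) (c'.2 l) → c'.1 ≤ c.1 := by
      intro x c c' h h'
      by_contra hlt
      have := mem_iInter.1 h' ⟨c.1, not_le.1 hlt⟩
      have hmem : x ∈ (R c.1)ᶜ := by
        rw [hRF]
        exact mem_iUnion.2 ⟨_, disjointed_subset _ _ this⟩
      exact hmem h
    rintro x ⟨n, s⟩ ⟨n', s'⟩ ⟨h1, h2⟩ ⟨h1', h2'⟩
    obtain rfl : n = n' := le_antisymm (hle x ⟨n', s'⟩ ⟨n, s⟩ h1' h2) (hle x ⟨n, s⟩ ⟨n', s'⟩ h1 h2')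
    congr
    funext l
    by_contra hne
    exact disjoint_left.1 (disjoint_disjointed (F l) hne) (mem_iInter.1 h2 l) (mem_iInter.1 h2' l)

/-- Every `Σ⁰₄` subset of a zero-dimensional space reduces to the family of subsets of `ℕ × ℕ` with
only finitely many infinite vertical sections. -/
theorem IsZeroDimensional.exists_reduction_of_isSigma0_four [SecondCountableTopology X]
    (hX : IsZeroDimensional X) {B : Set X} (hB : IsSigma0 4 B) :
    ∃ h : X → ℕ → ℕ → Bool, (∀ n m, Continuous fun x => h x n m) ∧
      ∀ x, x ∈ B ↔ {n | {m | h x n m = true}.Infinite}.Finite := by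
  obtain ⟨P, hP, rfl⟩ := isSigma0_add_two.1 hB
  choose D hD hPD hDu using fun i => hX.exists_disjoint_of_isSigma0_three (hP i)
  -- A tree argument: `T s` fails at x iff s correctly lists the piece of (P i)ᶜ containing x for
  -- all i below its length. Disjointness leaves at most one such s per length, and one exists for
  -- every length iff x lies in no `P i`.
  let I := Σ m : ℕ, Fin m → (Σ n : ℕ, Fin n → ℕ)
  let T (s : I) : Set X := ⋃ i : Fin s.1, (D i (s.2 i))ᶜ
  have hT (s : I) : IsSigma0 2 (T s) := IsSigma0.iUnion fun i => hD _ _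
  have hTB (x : X) : x ∈ ⋃ i, P i ↔ {s : I | x ∉ T s}.Finite := by
    have hmemT (s : I) : x ∉ T s ↔ ∀ i : Fin s.1, x ∈ D i (s.2 i) := by simp [T]
    constructor
    · intro hx
      obtain ⟨i, hi⟩ := mem_iUnion.1 hx
      refine Finite.of_finite_image (f := fun s => s.1) ?_ ?_
      · refine (finite_le_nat i).subset ?_
        rintro _ ⟨s, hs, rfl⟩
        by_contra hlt
        have h1 := (hmemT s).1 hs ⟨i, not_le.1 hlt⟩
        have h2 : x ∈ (P i)ᶜ := by
          rw [hPD]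
          exact mem_iUnion.2 ⟨_, h1⟩
        exact h2 hi
      · rintro ⟨m, s⟩ hs ⟨m', s'⟩ hs' h
        obtain rfl : m = m' := h
        congr
        funext i
        exact hDu i x _ _ ((hmemT _).1 hs i) ((hmemT _).1 hs' i)
    · intro hfin
      by_contra hx
      have hall (i : ℕ) : ∃ c, x ∈ D i c := by
        have : x ∈ (P i)ᶜ := fun h => hx (mem_iUnion.2 ⟨i, h⟩)
        rwa [hPD, mem_iUnion] at this
      choose c hc using hall
      refine infinite_of_injective_forall_mem
        (f := fun m : ℕ => (⟨m, fun i => c i⟩ : I)) ?_ ?_ hfin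
      · intro m m' h
        exact congrArg Sigma.fst h
      · intro m
        exact (hmemT _).2 fun i => hc i
  have : Infinite I := Infinite.of_injective (fun m : ℕ => (⟨m, fun _ => ⟨0, Fin.elim0⟩⟩ : I))
    fun m m' h => congrArg Sigma.fst h
  obtain ⟨e⟩ := nonempty_equiv_of_countable (α := ℕ) (β := I)
  choose y hy hyT using fun s => hX.exists_finite_iff_of_isSigma0_two (hT s)
  classical
  refine ⟨fun x n m => decide (x ∈ y (e n) m), fun n m => ?_, fun x => ?_⟩
  · refine continuous_discrete_rng.2 fun b => ?_
    cases b
    · convert (hy (e n) m).compl.isOpen using 1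
      ext x
      simp
    · convert (hy (e n) m).isOpen using 1
      ext x
      simp
  · rw [hTB]
    have : {n | {m | decide (x ∈ y (e n) m) = true}.Infinite} = e ⁻¹' {s | x ∉ T s} := by
      ext n
      simp [hyT]
    rw [this]
    exact ⟨fun h => h.preimage e.injective.injOn,
      fun h => image_preimage_eq {s | x ∉ T s} e.surjective ▸ h.image e⟩

end Reduction

/-! ### Copies of ℕ × ℕ inside ω². -/

section Blocks

theorem mem_derivedSet_ordinal_iff {x : Ordinal.{u}} {S : Set Ordinal.{u}} :
    x ∈ derivedSet S ↔ x ≠ 0 ∧ ∀ a < x, ∃ s ∈ S, a < s ∧ s < x := by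
  rw [mem_derivedSet, SuccOrder.accPt_principal]
  simp only [isMin_iff_eq_bot, Ordinal.bot_eq_zero, Set.Nonempty, mem_inter_iff, mem_Ioo]

/-- The points `η + ω * n + (m + 1)`, which form a copy of the isolated points of `ω ^ 2`. -/
noncomputable def blockPoint (η : Ordinal.{u}) (q : ℕ × ℕ) : Ordinal.{u} :=
  η + (ω * (q.1 : Ordinal) + ((q.2 + 1 : ℕ) : Ordinal))

theorem omega0_mul_add_natCast_inj {n n' m m' : ℕ}
    (h : ω * (n : Ordinal.{u}) + (m : Ordinal) = ω * (n' : Ordinal) + (m' : Ordinal)) :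
    n = n' ∧ m = m' := by
  have hdiv (n m : ℕ) : (ω * (n : Ordinal.{u}) + (m : Ordinal)) / ω = n := by
    rw [Ordinal.mul_add_div _ Ordinal.omega0_ne_zero,
      Ordinal.div_eq_zero_of_lt (Ordinal.natCast_lt_omega0 m), add_zero]
  have hn := congrArg (· / ω) h
  simp only [hdiv, Nat.cast_inj] at hn
  subst hn
  exact ⟨rfl, by simpa using h⟩

theorem blockPoint_injective (η : Ordinal.{u}) : Function.Injective (blockPoint η) := by
  rintro ⟨n, m⟩ ⟨n', m'⟩ h
  obtain ⟨rfl, h⟩ := omega0_mul_add_natCast_inj (add_left_cancel h)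
  simp_all

theorem lt_blockPoint (η : Ordinal.{u}) (q : ℕ × ℕ) : η < blockPoint η q := by
  rw [blockPoint, lt_add_iff_pos_right]
  exact lt_of_lt_of_le (by exact_mod_cast q.2.succ_pos) le_add_self

theorem omega0_mul_add_natCast_lt (n m : ℕ) :
    ω * (n : Ordinal.{u}) + (m : Ordinal) < ω * ((n + 1 : ℕ) : Ordinal) := by
  push_cast
  rw [mul_add, mul_one]
  exact (add_lt_add_iff_left _).2 (Ordinal.natCast_lt_omega0 m)

theorem blockPoint_lt (η : Ordinal.{u}) (q : ℕ × ℕ) : blockPoint η q < η + ω ^ (2 : Ordinal) := by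
  refine (add_lt_add_iff_left _).2 ((omega0_mul_add_natCast_lt _ _).trans ?_)
  rw [← one_add_one_eq_two, Ordinal.opow_add, Ordinal.opow_one]
  exact mul_lt_mul_of_pos_left (Ordinal.natCast_lt_omega0 _) Ordinal.omega0_pos

theorem exists_eq_of_lt_omega0_opow_two {ζ : Ordinal.{u}} (h : ζ < ω ^ (2 : Ordinal)) :
    ∃ n m : ℕ, ζ = ω * (n : Ordinal) + (m : Ordinal) := by
  rw [← one_add_one_eq_two, Ordinal.opow_add, Ordinal.opow_one] at h
  obtain ⟨q, hq, r, hr, rfl⟩ := Ordinal.lt_mul_iff.1 h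
  obtain ⟨n, rfl⟩ := Ordinal.lt_omega0.1 hq
  obtain ⟨m, rfl⟩ := Ordinal.lt_omega0.1 hr
  exact ⟨n, m, rfl⟩

theorem mem_derivedSet_blockPoint {η : Ordinal.{u}} {A : Set (ℕ × ℕ)} {n : ℕ}
    (h : {m | (n, m) ∈ A}.Infinite) :
    η + ω * ((n + 1 : ℕ) : Ordinal) ∈ derivedSet (blockPoint η '' A) := by
  refine mem_derivedSet_ordinal_iff.2 ⟨?_, fun a ha => ?_⟩
  · simp [Ordinal.omega0_ne_zero]
  · have : η + ω * ((n + 1 : ℕ) : Ordinal) = η + ω * (n : Ordinal) + ω := by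
      push_cast
      rw [mul_add, mul_one, add_assoc]
    rw [this] at ha
    obtain ⟨d, hd, had⟩ := (Ordinal.lt_add_iff Ordinal.omega0_ne_zero).1 ha
    obtain ⟨k, rfl⟩ := Ordinal.lt_omega0.1 hd
    obtain ⟨m, hm, hkm⟩ := h.exists_gt k
    refine ⟨_, ⟨(n, m), hm, rfl⟩, had.trans_lt ?_,
      (add_lt_add_iff_left _).2 (omega0_mul_add_natCast_lt _ _)⟩
    rw [blockPoint, add_assoc]
    refine (add_lt_add_iff_left _).2 ((add_lt_add_iff_left _).2 ?_)
    exact_mod_cast hkm.trans (Nat.lt_succ_self m)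

theorem derivedSet_blockPoint_subset (η : Ordinal.{u}) (A : Set (ℕ × ℕ)) :
    derivedSet (blockPoint η '' A) ⊆ insert (η + ω ^ (2 : Ordinal))
      ((fun n : ℕ => η + ω * ((n + 1 : ℕ) : Ordinal)) '' {n | {m | (n, m) ∈ A}.Infinite}) := by
  intro x hx
  obtain ⟨hx0, hx⟩ := mem_derivedSet_ordinal_iff.1 hx
  have hηx : η < x := by
    obtain ⟨_, ⟨q, -, rfl⟩, -, h⟩ := hx 0 (pos_iff_ne_zero.2 hx0)
    exact (lt_blockPoint η q).trans h
  obtain ⟨ζ, rfl⟩ := exists_add_of_le hηx.le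
  rcases lt_trichotomy ζ (ω ^ (2 : Ordinal)) with h | rfl | h
  · right
    obtain ⟨n, m, rfl⟩ := exists_eq_of_lt_omega0_opow_two h
    -- Otherwise x is a successor, with nothing strictly between it and its predecessor.
    have hm : m = 0 := by
      by_contra hm
      obtain ⟨k, rfl⟩ := Nat.exists_eq_succ_of_ne_zero hm
      have hlt : η + (ω * (n : Ordinal) + (k : Ordinal)) <
          η + (ω * (n : Ordinal) + ((k.succ : ℕ) : Ordinal)) := by
        refine (add_lt_add_iff_left _).2 ((add_lt_add_iff_left _).2 ?_)
        exact_mod_cast Nat.lt_succ_self k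
      obtain ⟨s, -, h1, h2⟩ := hx _ hlt
      rw [Nat.succ_eq_add_one, Nat.cast_add, Nat.cast_one, ← add_assoc, ← add_assoc,
        ← Order.succ_eq_add_one, Order.lt_succ_iff, add_assoc] at h2
      exact absurd h1 h2.not_gt
    subst hm
    simp only [Nat.cast_zero, add_zero] at hx hηx ⊢
    obtain ⟨k, rfl⟩ : ∃ k, n = k + 1 := by
      refine Nat.exists_eq_succ_of_ne_zero ?_
      rintro rfl
      simp at hηx
    refine ⟨k, ?_, rfl⟩
    -- If N bounded section k, no block point of A would lie strictly between η + ωk + (N+1) and η +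
    -- ω(k+1).
    refine infinite_of_not_bddAbove ?_
    rintro ⟨N, hN⟩
    obtain ⟨_, ⟨⟨n', m'⟩, hA, rfl⟩, h1, h2⟩ :=
      hx (η + (ω * (k : Ordinal) + ((N + 1 : ℕ) : Ordinal)))
        ((add_lt_add_iff_left _).2 (omega0_mul_add_natCast_lt _ _))
    have h1 := (add_lt_add_iff_left _).1 h1
    have h2 := (add_lt_add_iff_left _).1 h2
    simp only at h1 h2
    have hk : n' = k := by
      apply le_antisymm
      · have := le_add_right (le_refl (ω * (n' : Ordinal.{u}))) |>.trans_lt h2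
        have := (mul_lt_mul_iff_right₀ Ordinal.omega0_pos).1 this
        exact Nat.lt_succ_iff.1 (by exact_mod_cast this)
      · by_contra hlt
        have hle : ω * ((n' + 1 : ℕ) : Ordinal.{u}) ≤ ω * (k : Ordinal) :=
          mul_le_mul_right (by exact_mod_cast not_le.1 hlt) ω
        have := (omega0_mul_add_natCast_lt n' (m' + 1)).trans_le hle
        exact absurd (h1.trans this) (not_lt.2 le_self_add)
    subst hk
    have h3 := (add_lt_add_iff_left _).1 h1
    have : N < m' := by
      have : N + 1 < m' + 1 := by exact_mod_cast h3
      omega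
    exact absurd (hN hA) (not_le.2 this)
  · exact Or.inl rfl
  · obtain ⟨_, ⟨q, -, rfl⟩, h1, -⟩ := hx _ ((add_lt_add_iff_left η).2 h)
    exact absurd h1 (blockPoint_lt η q).not_gt

theorem derivedSet_blockPoint_finite_iff (η : Ordinal.{u}) (A : Set (ℕ × ℕ)) :
    (derivedSet (blockPoint η '' A)).Finite ↔ {n | {m | (n, m) ∈ A}.Infinite}.Finite := by
  constructor
  · intro h
    have hinj : Function.Injective fun n : ℕ => η + ω * ((n + 1 : ℕ) : Ordinal.{u}) := by
      intro n n' h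
      have := add_left_cancel h
      have := mul_left_cancel₀ Ordinal.omega0_ne_zero this
      have : n + 1 = n' + 1 := by exact_mod_cast this
      omega
    refine Finite.of_finite_image (h.subset ?_) hinj.injOn
    rintro _ ⟨n, hn, rfl⟩
    exact mem_derivedSet_blockPoint hn
  · intro h
    exact ((h.image _).insert _).subset (derivedSet_blockPoint_subset η A)

theorem derivedSet_blockPoint_univ_infinite (η : Ordinal.{u}) :
    (derivedSet (blockPoint η '' univ)).Infinite := by
  intro h
  rw [derivedSet_blockPoint_finite_iff] at h
  simp only [mem_univ, ofPred_true, infinite_univ] at h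
  exact infinite_univ h

end Blocks

/-! ### The families are ideals. -/

section Ideals

variable {α : Ordinal.{u}}

theorem blockPoint_zero_lt {γ : Ordinal.{u}} (h : 2 ≤ γ) (q : ℕ × ℕ) : blockPoint 0 q < ω ^ γ := by
  have := blockPoint_lt 0 q
  rw [zero_add] at this
  exact this.trans_le (Ordinal.opow_le_opow_right Ordinal.omega0_pos h)

theorem isIdealOn_convOrd (h2 : 2 ≤ α) (h : α.card ≤ Cardinal.aleph0) : IsIdealOn (convOrd α) where
  empty_mem := convIdeal_empty
  univ_notMem hu := by
    rw [mem_convOrd_iff h] at hu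
    refine derivedSet_blockPoint_univ_infinite 0 (hu.subset (derivedSet_mono _ _ ?_))
    rintro _ ⟨q, -, rfl⟩
    exact ⟨⟨_, (blockPoint_zero_lt h2 q).le⟩, mem_univ _, rfl⟩
  union_mem _ hA _ hB := convIdeal_union hA hB
  subset_mem _ _ := convIdeal_mono
  finite_mem _ := convIdeal_finite

theorem isIdealOn_convBelow (hl : Order.IsSuccLimit α) (h : α.card ≤ Cardinal.aleph0) :
    IsIdealOn (convBelow α) where
  empty_mem := by
    rw [mem_convBelow_iff h]
    intro β _
    simp [derivedSet_eq_empty_of_finite]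
  univ_notMem hu := by
    rw [mem_convBelow_iff h] at hu
    have h2 : (2 : Ordinal) < α := (Ordinal.natCast_lt_of_isSuccLimit hl 2)
    refine derivedSet_blockPoint_univ_infinite 0 ((hu 2 h2).subset (derivedSet_mono _ _ ?_))
    rintro _ ⟨q, -, rfl⟩
    exact ⟨⟨⟨_, (blockPoint_zero_lt h2.le q).le⟩, mem_univ _, rfl⟩, blockPoint_zero_lt le_rfl q⟩
  union_mem A hA B hB := by
    rw [mem_convBelow_iff h] at hA hB ⊢
    intro β hβ
    rw [image_union, union_inter_distrib_right, derivedSet_union]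
    exact (hA β hβ).union (hB β hβ)
  subset_mem A B hAB hB := by
    rw [mem_convBelow_iff h] at hB ⊢
    exact fun β hβ => (hB β hβ).subset (derivedSet_mono _ _
      (inter_subset_inter_left _ (image_mono hAB)))
  finite_mem A hA := by
    rw [mem_convBelow_iff h]
    intro β _
    simp [derivedSet_eq_empty_of_finite ((hA.image _).inter_of_left _)]

end Ideals

/-! ### Hardness through blocks. -/

section Completeness

variable {α : Ordinal.{u}}

theorem exists_continuous_setOf_eq_image {X : Type v} [TopologicalSpace X] {ι : Type*} {Y : Type u}
    {p : ι → Y} (hp : Function.Injective p) {h : X → ι → Bool}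
    (hh : ∀ i, Continuous fun x => h x i) :
    ∃ F : X → Y → Bool, Continuous F ∧ ∀ x, {y | F x y = true} = p '' {i | h x i = true} := by
  refine ⟨fun x => Function.extend p (h x) fun _ => false, continuous_pi fun y => ?_, fun x => ?_⟩
  · by_cases hy : ∃ i, p i = y
    · obtain ⟨i, rfl⟩ := hy
      simpa only [hp.extend_apply] using hh i
    · simpa only [Function.extend_apply' _ _ _ hy] using continuous_const
  · ext y
    by_cases hy : ∃ i, p i = y
    · obtain ⟨i, rfl⟩ := hy
      simp [hp.extend_apply, hp.eq_iff]
    · simp only [mem_ofPred_eq, Function.extend_apply' _ _ _ hy, mem_image]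
      simp only [Bool.false_eq_true, false_iff]
      rintro ⟨i, -, hi⟩
      exact hy ⟨i, hi⟩

theorem isSigma0Complete_convOrd (h2 : 2 ≤ α) (h : α.card ≤ Cardinal.aleph0) :
    IsSigma0Complete.{u + 1, v} 4 (toCantor (convOrd α)) := by
  refine ⟨isSigma0_toCantor_convOrd h, fun X _ _ hX B hB => ?_⟩
  obtain ⟨g, hg, hgB⟩ := hX.exists_reduction_of_isSigma0_four hB
  let p (q : ℕ × ℕ) : OmegaPowSpace α := ⟨blockPoint 0 q, (blockPoint_zero_lt h2 q).le⟩
  have hp : Function.Injective p := fun q q' hq =>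
    blockPoint_injective 0 (congrArg Subtype.val hq)
  obtain ⟨F, hF, hFp⟩ := exists_continuous_setOf_eq_image hp (h := fun x q => g x q.1 q.2)
    fun q => hg q.1 q.2
  refine ⟨F, hF, ?_⟩
  ext x
  change {y | F x y = true} ∈ convOrd α ↔ _
  rw [hFp, mem_convOrd_iff h, image_image, hgB]
  exact derivedSet_blockPoint_finite_iff 0 {q | g x q.1 q.2 = true}

/-- A countable limit ordinal is the limit of an increasing sequence. -/
theorem exists_strictMono_cofinal (hl : Order.IsSuccLimit α) (h : α.card ≤ Cardinal.aleph0) :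
    ∃ γ : ℕ → Ordinal.{u}, StrictMono γ ∧ (∀ k, γ k < α) ∧ (∀ k, 2 ≤ γ k) ∧
      ∀ β < α, ∃ k, β ≤ γ k := by
  have hc : Countable (Iio α) := countable_Iio_of_card_le h
  have h2 : (2 : Ordinal) < α := Ordinal.natCast_lt_of_isSuccLimit hl 2
  have : Nonempty (Iio α) := ⟨⟨2, h2⟩⟩
  obtain ⟨b, hb⟩ := exists_surjective_nat (Iio α)
  -- Taking the maximum with the k-th ordinal below α forces cofinality; the successor forces strict
  -- growth.
  let γ : ℕ → Ordinal.{u} := fun k => Nat.rec 2 (fun k o => Order.succ (max o (b k).1)) k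
  have hγ (k : ℕ) : γ (k + 1) = Order.succ (max (γ k) (b k).1) := rfl
  have hmono : StrictMono γ := strictMono_nat_of_lt_succ fun k => by
    rw [hγ]
    exact Order.lt_succ_of_le (le_max_left _ _)
  refine ⟨γ, hmono, fun k => ?_, fun k => hmono.monotone (Nat.zero_le k), fun β hβ => ?_⟩
  · induction k with
    | zero => exact h2
    | succ k ih => exact hl.succ_lt (max_lt ih (b k).2)
  · obtain ⟨k, hk⟩ := hb ⟨β, hβ⟩
    refine ⟨k + 1, ?_⟩
    rw [hγ, hk]
    exact (le_max_right _ _).trans (Order.le_succ _)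

/-- By additive indecomposability of ω^δ, the block starting at ω^γ ends before ω^δ, so successive
blocks are disjoint. -/
theorem omega0_opow_add_opow_two_lt {γ δ : Ordinal.{u}} (h2 : 2 ≤ γ) (h : γ < δ) :
    ω ^ γ + ω ^ (2 : Ordinal) < ω ^ δ := by
  have hγ : ω ^ γ < ω ^ δ := (Ordinal.opow_lt_opow_iff_right Ordinal.one_lt_omega0).2 h
  exact Ordinal.isPrincipal_add_omega0_opow δ hγ
    ((Ordinal.opow_le_opow_right Ordinal.omega0_pos h2).trans_lt hγ)

theorem isPi0Complete_convBelow (hl : Order.IsSuccLimit α) (h : α.card ≤ Cardinal.aleph0) :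
    IsPi0Complete.{u + 1, v} 5 (toCantor (convBelow α)) := by
  refine ⟨isPi0_toCantor_convBelow h, fun X _ _ hX B hB => ?_⟩
  obtain ⟨P, hP, hBP⟩ := isSigma0_add_two.1 hB
  choose g hg hgP using fun k => hX.exists_reduction_of_isSigma0_four (hP k)
  obtain ⟨γ, hmono, hγα, hγ2, hcof⟩ := exists_strictMono_cofinal hl h
  have hlt (k : ℕ) (q : ℕ × ℕ) {δ : Ordinal.{u}} (hδ : γ k < δ) :
      blockPoint (ω ^ γ k) q < ω ^ δ :=
    (blockPoint_lt _ q).trans (omega0_opow_add_opow_two_lt (hγ2 k) hδ)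
  let p (r : ℕ × (ℕ × ℕ)) : OmegaPowSpace α := ⟨blockPoint (ω ^ γ r.1) r.2, (hlt _ _ (hγα _)).le⟩
  have hne : ∀ k k' : ℕ, ∀ q q' : ℕ × ℕ, k < k' →
      blockPoint (ω ^ γ k) q ≠ blockPoint (ω ^ γ k') q' := fun k k' q q' hk =>
    ((hlt k q (hmono hk)).trans (lt_blockPoint _ q')).ne
  have hp : Function.Injective p := by
    rintro ⟨k, q⟩ ⟨k', q'⟩ hq
    have hq : blockPoint (ω ^ γ k) q = blockPoint (ω ^ γ k') q' := congrArg Subtype.val hq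
    obtain rfl : k = k' := by
      rcases lt_trichotomy k k' with hk | hk | hk
      · exact absurd hq (hne _ _ _ _ hk)
      · exact hk
      · exact absurd hq.symm (hne _ _ _ _ hk)
    rw [blockPoint_injective _ hq]
  obtain ⟨F, hF, hFp⟩ := exists_continuous_setOf_eq_image hp
    (h := fun x r => g r.1 x r.2.1 r.2.2) fun r => hg r.1 r.2.1 r.2.2
  refine ⟨F, hF, ?_⟩
  ext x
  let A (k : ℕ) : Set (ℕ × ℕ) := {q | g k x q.1 q.2 = true}
  have himg : Subtype.val '' {y | F x y = true} = ⋃ k, blockPoint (ω ^ γ k) '' A k := by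
    rw [hFp, image_image]
    ext y
    simp only [mem_image, mem_iUnion, A, p, mem_ofPred_eq, Prod.exists]
  have hB : x ∈ B ↔ ∀ k, (derivedSet (blockPoint (ω ^ γ k) '' A k)).Finite := by
    rw [← not_iff_not, ← mem_compl_iff, hBP]
    simp only [mem_iUnion, not_forall]
    refine exists_congr fun k => ?_
    rw [derivedSet_blockPoint_finite_iff, ← not_iff_not, ← mem_compl_iff, hgP, not_not]
    rfl
  change {y | F x y = true} ∈ convBelow α ↔ _
  rw [mem_convBelow_iff h, himg, hB]
  constructor
  · intro hx k
    refine (hx (Order.succ (γ k)) (hl.succ_lt (hγα k))).subset (derivedSet_mono _ _ ?_)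
    rintro y hy
    refine ⟨mem_iUnion.2 ⟨k, hy⟩, ?_⟩
    obtain ⟨q, -, rfl⟩ := hy
    exact hlt k q (Order.lt_succ _)
  · intro hx β hβ
    obtain ⟨N, hN⟩ := hcof β hβ
    -- Blocks with index at least N start at or beyond ω^β.
    have hsub : (⋃ k, blockPoint (ω ^ γ k) '' A k) ∩ Iio (ω ^ β) ⊆
        ⋃ k ∈ Iio N, blockPoint (ω ^ γ k) '' A k := by
      rintro y ⟨hy, hyβ⟩
      obtain ⟨k, hk⟩ := mem_iUnion.1 hy
      refine mem_biUnion (mem_Iio.2 ?_) hk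
      by_contra hNk
      obtain ⟨q, -, rfl⟩ := hk
      have h1 : ω ^ β ≤ ω ^ γ k := Ordinal.opow_le_opow_right Ordinal.omega0_pos
        (hN.trans (hmono.monotone (not_lt.1 hNk)))
      exact absurd (h1.trans_lt (lt_blockPoint _ q)) (mem_Iio.1 hyβ).not_gt
    refine Finite.subset ?_ (derivedSet_mono _ _ hsub)
    rw [derivedSet_biUnion (finite_Iio N)]
    exact (finite_Iio N).biUnion fun k _ => hx k

end Completeness

/-! ### Cluster values of a Katětov reduction. -/

section Cluster

variable {X : Type u} {Y : Type v} [TopologicalSpace X] [TopologicalSpace Y]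

/-- The limits of `f z` as `z` tends to `x` along some filter of points different from `x`. -/
def clusterSet (f : X → Y) (x : X) : Set Y := {y | MapClusterPt y (𝓝[≠] x) f}

theorem isClosed_clusterSet (f : X → Y) (x : X) : IsClosed (clusterSet f x) :=
  isClosed_setOfPred_clusterPt

theorem clusterSet_nonempty [CompactSpace Y] (f : X → Y) {x : X} (hx : (𝓝[≠] x).NeBot) :
    (clusterSet f x).Nonempty :=
  exists_clusterPt_of_compactSpace _

theorem exists_seq_of_mem_clusterSet [FirstCountableTopology X] {f : X → Y} {x : X} {y : Y}
    (h : y ∈ clusterSet f x) {V : ℕ → Set Y} (hV : ∀ j, V j ∈ 𝓝 y) :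
    ∃ z : ℕ → X, Tendsto z atTop (𝓝 x) ∧ (∀ j, z j ≠ x) ∧ ∀ j, f (z j) ∈ V j := by
  obtain ⟨B, hB⟩ := (𝓝 x).exists_antitone_basis
  have (j : ℕ) : ∃ z, z ∈ B j ∧ z ≠ x ∧ f z ∈ V j := by
    have h1 : ∃ᶠ z in 𝓝[≠] x, f z ∈ V j := MapClusterPt.frequently h (hV j)
    have h2 : ∀ᶠ z in 𝓝[≠] x, z ∈ B j := mem_nhdsWithin_of_mem_nhds (hB.mem j)
    obtain ⟨z, hz, hzB, hzx⟩ := (h1.and_eventually (h2.and self_mem_nhdsWithin)).exists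
    exact ⟨z, hzB, hzx, hz⟩
  choose z hzB hzx hzV using this
  exact ⟨z, hB.tendsto hzB, hzx, hzV⟩

theorem accPt_of_tendsto {z : ℕ → X} {x : X} (h : Tendsto z atTop (𝓝 x)) (hne : ∀ j, z j ≠ x)
    {A : Set X} (hA : ∀ j, z j ∈ A) : AccPt x (𝓟 A) := by
  rw [accPt_iff_nhds]
  intro U hU
  obtain ⟨j, hj⟩ := (h.eventually_mem hU).exists
  exact ⟨z j, ⟨hj, hA j⟩, hne j⟩

variable [FirstCountableTopology X] [T2Space X] [FirstCountableTopology Y]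
  {f : X → Y}

/-- Given infinitely many xᵢ with cluster value y, a double sequence zᵢⱼ → xᵢ can be chosen so that
all the f(zᵢⱼ), enumerated by pairing, form one sequence converging to y. The preimage of its range
accumulates at every xᵢ. -/
theorem finite_setOf_mem_clusterSet (hf : ∀ A ∈ convIdeal Y, f ⁻¹' A ∈ convIdeal X) (y : Y) :
    {x | y ∈ clusterSet f x}.Finite := by
  by_contra hinf
  let e := Set.Infinite.natEmbedding _ hinf
  obtain ⟨B, hB⟩ := (𝓝 y).exists_antitone_basis
  choose z hz hzx hzB using fun i : ℕ =>
    exists_seq_of_mem_clusterSet (e i).2 (V := fun j => B (Nat.pair i j)) fun j => hB.mem _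
  have hconv : Tendsto (fun k : ℕ => f (z k.unpair.1 k.unpair.2)) atTop (𝓝 y) :=
    hB.tendsto fun k => by simpa using hzB k.unpair.1 k.unpair.2
  have hfin := derivedSet_finite_of_mem_convIdeal (hf _ (convIdeal_range hconv))
  refine infinite_of_injective_forall_mem (f := fun i => (e i : X))
    (Subtype.val_injective.comp e.injective) (fun i => ?_) hfin
  exact accPt_of_tendsto (hz i) (hzx i) fun j => ⟨Nat.pair i j, by simp⟩

/-- Isolated cluster values yᵢ are attained by f arbitrarily near xᵢ. A convergent subsequence of
(yᵢ) then has a preimage accumulating at infinitely many xᵢ. -/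
theorem finite_setOf_clusterSet_inter_derivedSet_eq_empty [CompactSpace Y]
    (hf : ∀ A ∈ convIdeal Y, f ⁻¹' A ∈ convIdeal X) :
    {x | (𝓝[≠] x).NeBot ∧ clusterSet f x ∩ derivedSet univ = ∅}.Finite := by
  by_contra hinf
  let e := Set.Infinite.natEmbedding _ hinf
  choose y hy using fun i => clusterSet_nonempty f (e i).2.1
  obtain ⟨p, φ, hφ, hp⟩ := CompactSpace.tendsto_subseq y
  have hfin := derivedSet_finite_of_mem_convIdeal (hf _ (convIdeal_range hp))
  refine infinite_of_injective_forall_mem (f := fun i => (e (φ i) : X))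
    (Subtype.val_injective.comp (e.injective.comp hφ.injective)) (fun i => ?_) hfin
  have hiso : {y (φ i)} ∈ 𝓝 (y (φ i)) := by
    have hni : y (φ i) ∉ derivedSet univ := fun hd =>
      (eq_empty_iff_forall_notMem.1 (e (φ i)).2.2) _ ⟨hy _, hd⟩
    rw [mem_derivedSet, accPt_iff_nhds] at hni
    push Not at hni
    obtain ⟨U, hU, h⟩ := hni
    exact mem_of_superset hU fun w hw => h w ⟨hw, mem_univ _⟩
  obtain ⟨z, hz, hzx, hzy⟩ := exists_seq_of_mem_clusterSet (hy (φ i)) fun _ => hiso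
  exact accPt_of_tendsto hz hzx fun j => ⟨i, (mem_singleton_iff.1 (hzy j)).symm⟩

/-- If almost all points of a set `R` near `x` have cluster values in `S`, then `x` has a cluster
value that is an accumulation point of `S`. -/
theorem clusterSet_inter_derivedSet_nonempty [CompactSpace Y]
    (hf : ∀ A ∈ convIdeal Y, f ⁻¹' A ∈ convIdeal X) {R : Set X} {S : Set Y} {x : X}
    (hx : x ∈ derivedSet R) (hR : {x ∈ R | clusterSet f x ∩ S = ∅}.Finite) :
    (clusterSet f x ∩ derivedSet S).Nonempty := by
  have hNB : (𝓝[R \ {x}] x).NeBot := accPt_principal_iff_nhdsWithin.1 hx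
  have hfinite : ∀ F : Set X, F.Finite → ∀ᶠ z in 𝓝[R \ {x}] x, z ∉ F := by
    intro F hF
    have h1 : (F \ {x})ᶜ ∈ 𝓝 x := (hF.subset sdiff_subset).isClosed.isOpen_compl.mem_nhds (by simp)
    filter_upwards [mem_nhdsWithin_of_mem_nhds h1, self_mem_nhdsWithin] with z hz hzR hzF
    exact hz ⟨hzF, hzR.2⟩
  have hgood : ∀ᶠ z in 𝓝[R \ {x}] x, (clusterSet f z ∩ S).Nonempty := by
    filter_upwards [hfinite _ hR, self_mem_nhdsWithin] with z hz hzR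
    rw [nonempty_iff_ne_empty]
    exact fun h => hz ⟨hzR.1, h⟩
  obtain ⟨g, hg⟩ : ∃ g : X → Y, ∀ z, (clusterSet f z ∩ S).Nonempty → g z ∈ clusterSet f z ∩ S := by
    classical
    exact ⟨fun z => if h : (clusterSet f z ∩ S).Nonempty then h.some else f z, fun z h => by
      simpa only [h, dif_pos] using h.some_mem⟩
  -- Choose a cluster value g z in S at almost every z ∈ R near x; the ultrafilter limit y of g is a
  -- cluster value at x by a diagonal argument. It accumulates S because g z = y for only finitely
  -- many z.
  let U := Ultrafilter.of (𝓝[R \ {x}] x)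
  have hU : (U : Filter X) ≤ 𝓝[R \ {x}] x := Ultrafilter.of_le _
  let y := (U.map g).lim
  have hy : Tendsto g U (𝓝 y) := (U.map g).le_nhds_lim
  refine ⟨y, ?_, ?_⟩
  · change MapClusterPt y (𝓝[≠] x) f
    rw [mapClusterPt_iff_frequently]
    intro V hV
    rw [frequently_iff]
    intro W hW
    obtain ⟨W', hW'o, hxW', hW'⟩ := mem_nhdsWithin.1 hW
    have h1 : ∀ᶠ z in (U : Filter X), z ∈ W' ∧ z ∈ R \ {x} :=
      hU (inter_mem (mem_nhdsWithin_of_mem_nhds (hW'o.mem_nhds hxW')) self_mem_nhdsWithin)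
    obtain ⟨V', hV'V, hV'o, hyV'⟩ := mem_nhds_iff.1 hV
    obtain ⟨z, ⟨hzW', hzR⟩, hzV, hz⟩ := (h1.and
      ((hy.eventually_mem (hV'o.mem_nhds hyV')).and (hgood.filter_mono hU))).exists
    have h2 : ∃ᶠ w in 𝓝[≠] z, f w ∈ V' :=
      MapClusterPt.frequently (hg z hz).1 (hV'o.mem_nhds hzV)
    have h3 : ∀ᶠ w in 𝓝[≠] z, w ∈ W' ∩ {x}ᶜ :=
      mem_nhdsWithin_of_mem_nhds ((hW'o.inter isOpen_compl_singleton).mem_nhds ⟨hzW', hzR.2⟩)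
    obtain ⟨w, hwV, hw⟩ := (h2.and_eventually h3).exists
    exact ⟨w, hW' hw, hV'V hwV⟩
  · rw [mem_derivedSet, accPt_iff_nhds]
    intro V hV
    obtain ⟨z, hzV, hz, hzy⟩ := ((hy.eventually_mem hV).and ((hgood.filter_mono hU).and
      ((hfinite _ (finite_setOf_mem_clusterSet hf y)).filter_mono hU))).exists
    exact ⟨g z, ⟨hzV, (hg z hz).2⟩, fun h => hzy (h ▸ (hg z hz).1)⟩

end Cluster

/-! ### Cantor–Bendixson rank and its propagation. -/

section Rank

/-- The ordinals of Cantor–Bendixson rank at least `γ`, that is, the nonzero multiples of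
`ω ^ γ`. -/
def rankGE (γ : Ordinal.{u}) : Set Ordinal.{u} := {ξ | ξ ≠ 0 ∧ ω ^ γ ∣ ξ}

theorem omega0_opow_ne_zero (γ : Ordinal.{u}) : ω ^ γ ≠ 0 :=
  (Ordinal.opow_pos γ Ordinal.omega0_pos).ne'

theorem rankGE_anti {γ δ : Ordinal.{u}} (h : γ ≤ δ) : rankGE δ ⊆ rankGE γ :=
  fun _ hξ => ⟨hξ.1, (Ordinal.opow_dvd_opow _ h).trans hξ.2⟩

theorem omega0_opow_mem_rankGE (γ : Ordinal.{u}) : ω ^ γ ∈ rankGE γ :=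
  ⟨omega0_opow_ne_zero γ, dvd_rfl⟩

theorem le_of_mem_rankGE {γ ξ : Ordinal.{u}} (h : ξ ∈ rankGE γ) : ω ^ γ ≤ ξ :=
  Ordinal.le_of_dvd h.1 h.2

/-- Multiples of ω^γ accumulate exactly at ω^γ · q with q a limit, that is, at nonzero multiples of
ω^γ · ω. -/
theorem derivedSet_rankGE (γ : Ordinal.{u}) :
    derivedSet (rankGE γ) = rankGE (Order.succ γ) := by
  have h0 := omega0_opow_ne_zero γ
  have hpos := pos_iff_ne_zero.2 h0
  apply Subset.antisymm
  · intro ξ hξ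
    obtain ⟨hξ0, hξ⟩ := mem_derivedSet_ordinal_iff.1 hξ
    have hdvd : ω ^ γ ∣ ξ := by
      by_contra hnd
      have hlt : ω ^ γ * (ξ / ω ^ γ) < ξ :=
        (Ordinal.mul_div_le _ _).lt_of_ne fun h => hnd ⟨_, h.symm⟩
      obtain ⟨_, ⟨-, ⟨q, rfl⟩⟩, h1, h2⟩ := hξ _ hlt
      have h3 := (mul_lt_mul_iff_right₀ hpos).1 h1
      have h4 := h2.trans (Ordinal.lt_mul_succ_div ξ h0)
      have h5 := (mul_lt_mul_iff_right₀ hpos).1 h4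
      exact absurd h3 (Order.lt_succ_iff.1 h5).not_gt
    obtain ⟨q, rfl⟩ := hdvd
    refine ⟨hξ0, ?_⟩
    rw [Ordinal.opow_succ]
    refine mul_dvd_mul_left _ (Ordinal.isSuccPrelimit_iff_omega0_dvd.1 ?_)
    refine Order.isSuccPrelimit_of_succ_ne fun r hr => ?_
    subst hr
    obtain ⟨_, ⟨-, ⟨q, rfl⟩⟩, h1, h2⟩ :=
      hξ (ω ^ γ * r) ((mul_lt_mul_iff_right₀ hpos).2 (Order.lt_succ r))
    have h3 := (mul_lt_mul_iff_right₀ hpos).1 h1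
    have h5 := (mul_lt_mul_iff_right₀ hpos).1 h2
    exact absurd h3 (Order.lt_succ_iff.1 h5).not_gt
  · rintro ξ ⟨hξ0, ⟨q, rfl⟩⟩
    rw [Ordinal.opow_succ, mul_assoc] at hξ0 ⊢
    refine mem_derivedSet_ordinal_iff.2 ⟨hξ0, fun a ha => ?_⟩
    have hq : Order.IsSuccPrelimit (ω * q) := Ordinal.isSuccPrelimit_iff_omega0_dvd.2 ⟨q, rfl⟩
    have hdiv : a / ω ^ γ < ω * q := (Ordinal.lt_mul_iff_div_lt h0).1 ha
    refine ⟨ω ^ γ * Order.succ (a / ω ^ γ), ⟨?_, dvd_mul_right _ _⟩, Ordinal.lt_mul_succ_div a h0,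
      (mul_lt_mul_iff_right₀ hpos).2 (hq.succ_lt hdiv)⟩
    exact (mul_pos hpos (Order.bot_lt_succ _)).ne'

/-- A nonzero remainder of ξ modulo ω^γ would lie below some ω^δ with δ < γ, yet be divisible by
ω^δ. -/
theorem mem_rankGE_of_isSuccLimit {γ ξ : Ordinal.{u}} (hγ : Order.IsSuccLimit γ)
    (h : ∀ δ < γ, ξ ∈ rankGE δ) : ξ ∈ rankGE γ := by
  have h0 : ξ ≠ 0 := (h 0 hγ.bot_lt).1
  refine ⟨h0, ?_⟩
  rw [Ordinal.dvd_iff_mod_eq_zero]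
  by_contra hr
  obtain ⟨δ, hδ, hlt⟩ := (Ordinal.lt_opow_of_isSuccLimit Ordinal.omega0_ne_zero hγ).1
    (Ordinal.mod_lt ξ (omega0_opow_ne_zero γ))
  have hd : ω ^ δ ∣ ξ % ω ^ γ := by
    have h1 := (h δ hδ).2
    rw [← Ordinal.div_add_mod ξ (ω ^ γ)] at h1
    exact (Ordinal.dvd_add_iff ((Ordinal.opow_dvd_opow _ hδ.le).mul_right _)).1 h1
  exact absurd (Ordinal.le_of_dvd hr hd) hlt.not_ge

theorem isClosed_rankGE_succ (γ : Ordinal.{u}) : IsClosed (rankGE (Order.succ γ)) := by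
  rw [← derivedSet_rankGE]
  exact isClosed_derivedSet _

theorem derivedSet_preimage_val_Iic (o : Ordinal.{u}) (S : Set Ordinal.{u}) :
    derivedSet ((↑) ⁻¹' S : Set (Iic o)) = (↑) ⁻¹' derivedSet S := by
  ext x
  rw [mem_derivedSet, ← comap_principal]
  exact (isOpen_Iic_ordinal o).isOpenEmbedding_subtypeVal.accPt_comap_iff

variable {α β : Ordinal.{u}}

theorem firstCountableTopology_omegaPowSpace (hα : α.card ≤ Cardinal.aleph0) :
    FirstCountableTopology (OmegaPowSpace α) :=
  have := secondCountableTopology_Iic_ordinal (countable_Iic_omega0_opow hα)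
  inferInstance

theorem derivedSet_univ_ordinal : derivedSet (univ : Set Ordinal.{u}) = rankGE 1 := by
  have h1 : (1 : Ordinal.{u}) = Order.succ 0 := by simp
  rw [h1, ← derivedSet_rankGE]
  refine Subset.antisymm (fun x hx => ?_) (derivedSet_mono _ _ (subset_univ _))
  rw [mem_derivedSet_ordinal_iff] at hx ⊢
  refine ⟨hx.1, fun a ha => ?_⟩
  obtain ⟨s, -, h⟩ := hx.2 a ha
  exact ⟨s, ⟨(pos_of_gt h.1).ne', by simp⟩, h⟩

theorem clusterSet_inter_rankGE_succ_nonempty (hα : α.card ≤ Cardinal.aleph0)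
    (hβ : β.card ≤ Cardinal.aleph0) {f : OmegaPowSpace α → OmegaPowSpace β}
    (hf : ∀ A ∈ convOrd β, f ⁻¹' A ∈ convOrd α) {δ : Ordinal.{u}}
    (hδ : {x : OmegaPowSpace α | x ∈ (↑) ⁻¹' rankGE δ ∧
      clusterSet f x ∩ (↑) ⁻¹' rankGE δ = ∅}.Finite)
    {x : OmegaPowSpace α} (hx : (x : Ordinal) ∈ rankGE (Order.succ δ)) :
    (clusterSet f x ∩ (↑) ⁻¹' rankGE (Order.succ δ)).Nonempty := by
  have := firstCountableTopology_omegaPowSpace hα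
  have := firstCountableTopology_omegaPowSpace hβ
  have := compactSpace_Iic_ordinal (ω ^ β)
  rw [← derivedSet_rankGE, ← derivedSet_preimage_val_Iic]
  refine clusterSet_inter_derivedSet_nonempty hf ?_ hδ
  rw [derivedSet_preimage_val_Iic, derivedSet_rankGE]
  exact hx

theorem clusterSet_inter_rankGE_nonempty_of_forall_lt (hα : α.card ≤ Cardinal.aleph0)
    (hβ : β.card ≤ Cardinal.aleph0) {f : OmegaPowSpace α → OmegaPowSpace β}
    (hf : ∀ A ∈ convOrd β, f ⁻¹' A ∈ convOrd α) {γ : Ordinal.{u}} (hγ : 1 < γ)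
    (h : ∀ δ < γ, 1 ≤ δ → {x : OmegaPowSpace α | x ∈ (↑) ⁻¹' rankGE δ ∧
      clusterSet f x ∩ (↑) ⁻¹' rankGE δ = ∅}.Finite)
    {x : OmegaPowSpace α} (hx : (x : Ordinal) ∈ rankGE γ) :
    (clusterSet f x ∩ (↑) ⁻¹' rankGE γ).Nonempty := by
  rcases Ordinal.zero_or_succ_or_isSuccLimit γ with rfl | ⟨δ, rfl⟩ | hl
  · simp at hγ
  · exact clusterSet_inter_rankGE_succ_nonempty hα hβ hf
      (h δ (Order.lt_succ δ) (Order.lt_succ_iff.1 hγ)) hx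
  · have := compactSpace_Iic_ordinal (ω ^ β)
    have : Nonempty (Ico 1 γ) := ⟨⟨1, le_rfl, hγ⟩⟩
    -- At a limit γ, compactness intersects the levels below. Successor levels are used because they
    -- are derived sets, hence closed.
    have hclosed (δ : Ico 1 γ) : IsClosed (clusterSet f x ∩ (↑) ⁻¹' rankGE (Order.succ δ.1)) :=
      (isClosed_clusterSet f x).inter ((isClosed_rankGE_succ _).preimage continuous_subtype_val)
    have hdir : Directed (· ⊇ ·)
        fun δ : Ico 1 γ => clusterSet f x ∩ (↑) ⁻¹' rankGE (Order.succ δ.1) := fun δ δ' =>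
      ⟨max δ δ', inter_subset_inter_right _
          (preimage_mono (rankGE_anti (Order.succ_le_succ (le_max_left δ.1 δ'.1)))),
        inter_subset_inter_right _
          (preimage_mono (rankGE_anti (Order.succ_le_succ (le_max_right δ.1 δ'.1))))⟩
    obtain ⟨y, hy⟩ := IsCompact.nonempty_iInter_of_directed_nonempty_isCompact_isClosed _ hdir
      (fun δ => clusterSet_inter_rankGE_succ_nonempty hα hβ hf (h δ.1 δ.2.2 δ.2.1)
        (rankGE_anti (Order.succ_le_of_lt δ.2.2) hx)) (fun δ => (hclosed δ).isCompact) hclosed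
    rw [mem_iInter] at hy
    refine ⟨y, (hy ⟨1, le_rfl, hγ⟩).1, mem_rankGE_of_isSuccLimit hl fun δ hδ => ?_⟩
    refine rankGE_anti ?_ (hy ⟨max 1 δ, le_max_left _ _, max_lt hγ hδ⟩).2
    exact (le_max_right _ _).trans (Order.le_succ _)

/-- The induction starts at rank 1 because isolated points have no cluster values. Finitely many
exceptions can occur at rank 1; beyond it there are none. -/
theorem finite_setOf_clusterSet_inter_rankGE_eq_empty (hα : α.card ≤ Cardinal.aleph0)
    (hβ : β.card ≤ Cardinal.aleph0) {f : OmegaPowSpace α → OmegaPowSpace β}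
    (hf : ∀ A ∈ convOrd β, f ⁻¹' A ∈ convOrd α) {γ : Ordinal.{u}} (hγ : 1 ≤ γ) :
    {x : OmegaPowSpace α | x ∈ (↑) ⁻¹' rankGE γ ∧
      clusterSet f x ∩ (↑) ⁻¹' rankGE γ = ∅}.Finite := by
  induction γ using WellFoundedLT.induction with
  | ind γ ih =>
    rcases hγ.eq_or_lt with rfl | hlt
    · have := firstCountableTopology_omegaPowSpace hα
      have := firstCountableTopology_omegaPowSpace hβ
      have := compactSpace_Iic_ordinal (ω ^ β)
      refine (finite_setOf_clusterSet_inter_derivedSet_eq_empty hf).subset ?_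
      rintro x ⟨hx, hxK⟩
      rw [← derivedSet_univ_ordinal, ← derivedSet_preimage_val_Iic, preimage_univ] at hx hxK
      refine ⟨?_, hxK⟩
      simpa [AccPt] using (mem_derivedSet.1 hx)
    · convert finite_empty
      refine eq_empty_of_forall_notMem fun x hx => ?_
      exact (clusterSet_inter_rankGE_nonempty_of_forall_lt hα hβ hf hlt
        (fun δ hδ hδ1 => ih δ hδ hδ1) hx.1).ne_empty hx.2

theorem clusterSet_inter_rankGE_nonempty (hα : α.card ≤ Cardinal.aleph0)
    (hβ : β.card ≤ Cardinal.aleph0) {f : OmegaPowSpace α → OmegaPowSpace β}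
    (hf : ∀ A ∈ convOrd β, f ⁻¹' A ∈ convOrd α) {γ : Ordinal.{u}} (hγ : 1 < γ)
    {x : OmegaPowSpace α} (hx : (x : Ordinal) ∈ rankGE γ) :
    (clusterSet f x ∩ (↑) ⁻¹' rankGE γ).Nonempty :=
  clusterSet_inter_rankGE_nonempty_of_forall_lt hα hβ hf hγ
    (fun _ _ h1 => finite_setOf_clusterSet_inter_rankGE_eq_empty hα hβ hf h1) hx

end Rank

/-! ### Comparisons in the Katětov order. -/

section Katetov

variable {α β : Ordinal.{u}}

theorem katetovLE_convOrd (hα : α.card ≤ Cardinal.aleph0) (h : β ≤ α) :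
    KatetovLE (convOrd α) (convOrd β) := by
  have hle : ω ^ β ≤ ω ^ α := Ordinal.opow_le_opow_right Ordinal.omega0_pos h
  refine ⟨inclusion (Iic_subset_Iic.2 hle), fun A hA => ?_⟩
  rw [mem_convOrd_iff hα] at hA
  rw [mem_convOrd_iff (card_le_aleph0_of_le hα h)]
  refine hA.subset (derivedSet_mono _ _ ?_)
  rintro _ ⟨x, hx, rfl⟩
  exact ⟨_, hx, rfl⟩

theorem not_katetovLE_convOrd (h2 : 2 ≤ β) (h : β < α) (hα : α.card ≤ Cardinal.aleph0) :
    ¬ KatetovLE (convOrd β) (convOrd α) := by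
  rintro ⟨f, hf⟩
  have hβ := card_le_aleph0_of_le hα h.le
  have := firstCountableTopology_omegaPowSpace hα
  have := firstCountableTopology_omegaPowSpace hβ
  have h1 : 1 < β := one_lt_two.trans_le h2
  have hpos : 0 < ω ^ β := Ordinal.opow_pos β Ordinal.omega0_pos
  have hle (n : ℕ) : ω ^ β * ((n + 1 : ℕ) : Ordinal) ≤ ω ^ α := by
    refine le_trans ?_ (Ordinal.opow_le_opow_right Ordinal.omega0_pos (Order.succ_le_of_lt h))
    rw [Ordinal.opow_succ]
    exact mul_le_mul_right (Ordinal.natCast_lt_omega0 _).le _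
  -- The points ω^β · (n+1) all have rank at least β, and ω^β is the only such point of ω^β + 1, so
  -- it is a cluster value at all of them.
  refine infinite_of_injective_forall_mem
    (f := fun n : ℕ => (⟨ω ^ β * ((n + 1 : ℕ) : Ordinal), hle n⟩ : OmegaPowSpace α))
    (fun n n' hn => ?_) (fun n => ?_)
    (finite_setOf_mem_clusterSet hf (⟨ω ^ β, mem_Iic.2 le_rfl⟩ : OmegaPowSpace β))
  · have hn := mul_left_cancel₀ hpos.ne' (congrArg Subtype.val hn)
    have : n + 1 = n' + 1 := by exact_mod_cast hn
    omega
  · obtain ⟨y, hy, hyR⟩ := clusterSet_inter_rankGE_nonempty hα hβ hf h1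
      (x := ⟨ω ^ β * ((n + 1 : ℕ) : Ordinal), hle n⟩)
      ⟨mul_ne_zero hpos.ne' (by exact_mod_cast n.succ_ne_zero), dvd_mul_right _ _⟩
    have : y = ⟨ω ^ β, mem_Iic.2 le_rfl⟩ := Subtype.ext (le_antisymm y.2 (le_of_mem_rankGE hyR))
    exact this ▸ hy

theorem convOrd_subset_convBelow (hα : α.card ≤ Cardinal.aleph0) : convOrd α ⊆ convBelow α := by
  intro A hA
  rw [mem_convOrd_iff hα] at hA
  rw [mem_convBelow_iff hα]
  exact fun β _ => hA.subset (derivedSet_mono _ _ inter_subset_left)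

theorem katetovLE_convBelow (hα : α.card ≤ Cardinal.aleph0) (h : β ≤ α) :
    KatetovLE (convBelow α) (convBelow β) := by
  have hle : ω ^ β ≤ ω ^ α := Ordinal.opow_le_opow_right Ordinal.omega0_pos h
  refine ⟨inclusion (Iic_subset_Iic.2 hle), fun A hA => ?_⟩
  rw [mem_convBelow_iff hα] at hA
  rw [mem_convBelow_iff (card_le_aleph0_of_le hα h)]
  refine fun δ hδ => (hA δ (hδ.trans_le h)).subset (derivedSet_mono _ _ ?_)
  rintro _ ⟨⟨x, hx, rfl⟩, hxδ⟩
  exact ⟨⟨_, hx, rfl⟩, hxδ⟩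

/-- The trace on ω^α omits the top point, which cannot affect accumulation. -/
theorem derivedSet_finite_of_inter_Iio {A : Set (OmegaPowSpace α)} {S : Set Ordinal.{u}}
    (hA : ∀ x ∈ A, (x : Ordinal) ∈ S) (hS : (derivedSet (S ∩ Iio (ω ^ α))).Finite) :
    (derivedSet (Subtype.val '' A)).Finite := by
  have hsub : Subtype.val '' A ⊆ (S ∩ Iio (ω ^ α)) ∪ {ω ^ α} := by
    rintro _ ⟨x, hx, rfl⟩
    rcases (mem_Iic.1 x.2).lt_or_eq with h | h
    · exact Or.inl ⟨hA x hx, h⟩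
    · exact Or.inr h
  refine Finite.subset ?_ (derivedSet_mono _ _ hsub)
  rw [derivedSet_union, derivedSet_eq_empty_of_finite (finite_singleton _), union_empty]
  exact hS

theorem katetovLE_convBelow_convOrd (hα : α.card ≤ Cardinal.aleph0) (h : β < α) :
    KatetovLE (convBelow α) (convOrd β) := by
  have hle : ω ^ β ≤ ω ^ α := Ordinal.opow_le_opow_right Ordinal.omega0_pos h.le
  refine ⟨inclusion (Iic_subset_Iic.2 hle), fun A hA => ?_⟩
  rw [mem_convBelow_iff hα] at hA
  rw [mem_convOrd_iff (card_le_aleph0_of_le hα h.le)]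
  exact derivedSet_finite_of_inter_Iio (S := Subtype.val '' A) (fun x hx => ⟨_, hx, rfl⟩) (hA β h)

theorem KatetovLE.trans {X : Type u} {Y : Type v} {Z : Type w} {I : Set (Set X)} {J : Set (Set Y)}
    {K : Set (Set Z)} (h : KatetovLE I J) (h' : KatetovLE J K) : KatetovLE I K := by
  obtain ⟨f, hf⟩ := h
  obtain ⟨g, hg⟩ := h'
  exact ⟨f ∘ g, fun A hA => hg _ (hf A hA)⟩

/-- Since β + 1 < α, composing with conv_{<α} ≤ conv_{β+1} would give conv_β ≤ conv_{β+1}. -/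
theorem not_katetovLE_convOrd_convBelow (hl : Order.IsSuccLimit α) (h2 : 2 ≤ β) (h : β < α)
    (hα : α.card ≤ Cardinal.aleph0) : ¬ KatetovLE (convOrd β) (convBelow α) := fun hK =>
  have hs := hl.succ_lt h
  not_katetovLE_convOrd h2 (Order.lt_succ β) (card_le_aleph0_of_le hα hs.le)
    (hK.trans (katetovLE_convBelow_convOrd hα hs))

theorem katetovLE_convOrd_convBelow (hα : α.card ≤ Cardinal.aleph0) :
    KatetovLE (convOrd α) (convBelow α) :=
  ⟨id, fun _ hA => convOrd_subset_convBelow hα hA⟩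

theorem not_katetovLE_convBelow_convOrd (hl : Order.IsSuccLimit α)
    (hα : α.card ≤ Cardinal.aleph0) : ¬ KatetovLE (convBelow α) (convOrd α) := by
  rintro ⟨f, hf⟩
  have := firstCountableTopology_omegaPowSpace hα
  have hf' : ∀ A ∈ convOrd α, f ⁻¹' A ∈ convOrd α := fun A hA =>
    hf A (convOrd_subset_convBelow hα hA)
  obtain ⟨γ, hmono, hγα, hγ2, hcof⟩ := exists_strictMono_cofinal hl hα
  have hlt (k : ℕ) : ω ^ Order.succ (γ k) < ω ^ α :=
    (Ordinal.opow_lt_opow_iff_right Ordinal.one_lt_omega0).2 (hl.succ_lt (hγα k))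
  let x (k : ℕ) : OmegaPowSpace α := ⟨ω ^ Order.succ (γ k), (hlt k).le⟩
  have hx : Function.Injective x := fun k k' hk => by
    have := (Ordinal.opow_right_inj Ordinal.one_lt_omega0).1 (congrArg Subtype.val hk)
    exact hmono.injective (Order.succ_injective this)
  -- Each xₖ = ω^(γₖ+1) has a cluster value yₖ ≥ ω^(γₖ+1). Sequences zₖⱼ → xₖ with f(zₖⱼ) → yₖ and
  -- f(zₖⱼ) > ω^γₖ have images whose union is in conv_{<α}, while its preimage accumulates at every
  -- xₖ.
  choose y hy hyR using fun k => clusterSet_inter_rankGE_nonempty hα hα hf'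
    ((one_lt_two.trans_le (hγ2 k)).trans (Order.lt_succ (γ k))) (x := x k)
    (omega0_opow_mem_rankGE _)
  choose B hB using fun k => (𝓝 (y k)).exists_antitone_basis
  let o (k : ℕ) : OmegaPowSpace α :=
    ⟨ω ^ γ k, Ordinal.opow_le_opow_right Ordinal.omega0_pos (hγα k).le⟩
  have hV (k j : ℕ) : B k j ∩ Ioi (o k) ∈ 𝓝 (y k) := by
    refine inter_mem ((hB k).mem j) (isOpen_Ioi.mem_nhds (mem_Ioi.2 (Subtype.mk_lt_mk.2 ?_)))
    refine lt_of_lt_of_le ?_ (le_of_mem_rankGE (hyR k))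
    exact (Ordinal.opow_lt_opow_iff_right Ordinal.one_lt_omega0).2 (Order.lt_succ _)
  choose z hz hzx hzV using fun k => exists_seq_of_mem_clusterSet (hy k) (hV k)
  have hconv (k : ℕ) : Tendsto (fun j => f (z k j)) atTop (𝓝 (y k)) :=
    (hB k).tendsto fun j => (hzV k j).1
  have hS : (⋃ k, range fun j => f (z k j)) ∈ convBelow α := by
    rw [mem_convBelow_iff hα]
    intro δ hδ
    obtain ⟨N, hN⟩ := hcof δ hδ
    have hfin : (⋃ k ∈ Iio N, range fun j => f (z k j)) ∈ convOrd α :=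
      convIdeal_biUnion (finite_Iio N) fun k _ => convIdeal_range (hconv k)
    rw [mem_convOrd_iff hα] at hfin
    refine hfin.subset (derivedSet_mono _ _ ?_)
    rintro _ ⟨⟨w, hw, rfl⟩, hwδ⟩
    obtain ⟨k, j, rfl⟩ := mem_iUnion.1 hw
    refine ⟨_, mem_biUnion (mem_Iio.2 ?_) ⟨j, rfl⟩, rfl⟩
    by_contra hk
    have h1 : ω ^ δ ≤ ω ^ γ k := Ordinal.opow_le_opow_right Ordinal.omega0_pos
      (hN.trans (hmono.monotone (not_lt.1 hk)))
    have h2 : ω ^ γ k < (f (z k j) : Ordinal) := (hzV k j).2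
    exact absurd (h1.trans_lt h2) (mem_Iio.1 hwδ).not_gt
  refine infinite_of_injective_forall_mem hx (fun k => ?_)
    (derivedSet_finite_of_mem_convIdeal (hf _ hS))
  exact accPt_of_tendsto (hz k) (hzx k) fun j => mem_iUnion.2 ⟨k, j, rfl⟩

end Katetov

theorem mainTheorem2 :
    -- `conv_{<α}` is a `Π⁰₅`-complete ideal for every countable limit ordinal `α`
    (∀ α : Ordinal.{u}, Order.IsSuccLimit α → α.card ≤ Cardinal.aleph0 →
      IsIdealOn (convBelow α) ∧ IsPi0Complete.{u + 1, v} 5 (toCantor (convBelow α))) ∧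
    -- `conv_α` is a `Σ⁰₄`-complete ideal for every countable ordinal `α ≥ 2`
    (∀ α : Ordinal.{u}, 2 ≤ α → α.card ≤ Cardinal.aleph0 →
      IsIdealOn (convOrd α) ∧ IsSigma0Complete.{u + 1, v} 4 (toCantor (convOrd α))) ∧
    -- the ideals `conv_α` strictly decrease in the Katětov order
    (∀ α β : Ordinal.{u}, 2 ≤ β → β < α → α.card ≤ Cardinal.aleph0 →
      KatetovLT (convOrd α) (convOrd β)) ∧
    -- the ideals `conv_{<α}` strictly decrease in the Katětov order
    (∀ α β : Ordinal.{u}, Order.IsSuccLimit α → Order.IsSuccLimit β → β < α →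
      α.card ≤ Cardinal.aleph0 → KatetovLT (convBelow α) (convBelow β)) ∧
    -- the two chains are intertwined
    (∀ α : Ordinal.{u}, Order.IsSuccLimit α → α.card ≤ Cardinal.aleph0 →
      KatetovLT (convOrd α) (convBelow α) ∧
      ∀ β : Ordinal.{u}, 2 ≤ β → β < α → KatetovLT (convBelow α) (convOrd β)) := by
  refine ⟨fun α hl h => ⟨isIdealOn_convBelow hl h, isPi0Complete_convBelow hl h⟩,
    fun α h2 h => ⟨isIdealOn_convOrd h2 h, isSigma0Complete_convOrd h2 h⟩,
    fun α β h2 hlt h => ⟨katetovLE_convOrd h hlt.le, not_katetovLE_convOrd h2 hlt h⟩,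
    fun α β hl hlβ hlt h => ⟨katetovLE_convBelow h hlt.le, fun hK => ?_⟩,
    fun α hl h => ⟨⟨katetovLE_convOrd_convBelow h, not_katetovLE_convBelow_convOrd hl h⟩,
      fun β h2 hlt => ⟨katetovLE_convBelow_convOrd h hlt,
        not_katetovLE_convOrd_convBelow hl h2 hlt h⟩⟩⟩
  -- A reduction conv_{<β} ≤ conv_{<α} would compose with conv_β ≤ conv_{<β} to give the excluded
  -- conv_β ≤ conv_{<α}.
  exact not_katetovLE_convOrd_convBelow hl (Ordinal.natCast_lt_of_isSuccLimit hlβ 2).le hlt h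
    ((katetovLE_convOrd_convBelow (card_le_aleph0_of_le h hlt.le)).trans hK)
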